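/- Let $\mathrm{sgn}(t)=+1$ for $t>0$ and $\mathrm{sgn}(t)=-1$ for $t\le 0$, applied coordinatewise to vectors. A vector is $s$-sparse if at most $s$ of its coordinates are nonzero; let $\mathbb S^{n-1}_s$ be the set of $s$-sparse unit vectors of $\mathbb R^n$. For $x,y\in\mathbb S^{n-1}$ let $d(x,y)=\frac1\pi\arccos\langle x,y\rangle$ be the normalized geodesic distance, and for $a,b\in\{\pm1\}^m$ let $d_{\mathcal H^m}(a,b)=\frac1m|\{k: a_k\ne b_k\}|$. A map $\Phi:\mathbb R^n\to\{\pm1\}^m$ has the $(s,\delta)$-RIP if $\sup_{x,y\in\mathbb S^{n-1}_s}|d_{\mathcal H^m}(\Phi x,\Phi y)-d(x,y)|\le\delta$. There is an absolute constant $C>0$ such that the following holds. Let $1\le s\le n$ and $m$ be integers, $\sigma\ge 0$, $0<\varepsilon<1$, and $$\delta>1-\tfrac1\pi\arccos\Big(\tfrac{\sigma^2-1}{\sigma^2+1}\Big).$$ Let $A$ be a random $m\times n$ matrix whose rows are independent standard Gaussian vectors in $\mathbb R^n$, and let $\eta\sim\mathcal N(0,\sigma^2 I_m)$ be independent of $A$.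 Then $x\mapsto\mathrm{sgn}(Ax+\eta)$ has the $(s,\delta)$-RIP with probability at least $1-\varepsilon$, provided that $$m\ \ge\ C\Big[\delta+\tfrac1\pi\arccos\Big(\tfrac{\sigma^2-1}{\sigma^2+1}\Big)-1\Big]^{-2}\Big[\log(2/\varepsilon)+s\log(en/s)\Big].$$ If $2s\le n$, the same conclusion already holds provided that $$m\ \ge\ C\Big[\delta+\tfrac1\pi\arccos\Big(\tfrac{\sigma^2-1}{\sigma^2+1}\Big)-1\Big]^{-2}\Big[\log(2/\varepsilon)+s\log(n/s)\Big].$$ -/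

import Mathlib

open MeasureTheory ProbabilityTheory

namespace OneBit

/-- The sign map `ℝ → {±1}`, with `sgn t = +1` for `t > 0` and `sgn t = -1` for `t ≤ 0`.
The set `{±1}` is the group of units of `ℤ`. -/
noncomputable def sgn (t : ℝ) : ℤˣ := if 0 < t then 1 else -1

/-- The Hamming cube `{±1}^m`. -/
abbrev HammingCube (m : ℕ) : Type := Fin m → ℤˣ

/-- The normalized Hamming metric: the proportion of coordinates at which `a` and `b` differ. -/
noncomputable def hammingMetric {m : ℕ} (a b : HammingCube m) : ℝ :=
  (hammingDist a b : ℝ) / (m : ℝ)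

/-- Unit vectors of `ℝⁿ` with at most `s` nonzero coordinates. -/
def sparseSphere (n s : ℕ) : Set (EuclideanSpace ℝ (Fin n)) :=
  {x | ‖x‖ = 1 ∧ {j : Fin n | x j ≠ 0}.ncard ≤ s}

/-- Geodesic distance on the unit sphere, normalized so that antipodal points are at distance `1`. -/
noncomputable def geodesicDist {n : ℕ} (x y : EuclideanSpace ℝ (Fin n)) : ℝ :=
  1 / Real.pi * Real.arccos (inner ℝ x y)

/-- The `(s, δ)`-RIP of a map into the Hamming cube, with respect to the geodesic distance:
`sup_{x, y} |d_H(Φ x, Φ y) - d(x, y)| ≤ δ` over unit `s`-sparse vectors `x, y`. -/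
def HasRIP {n m : ℕ} (s : ℕ) (δ : ℝ) (Φ : EuclideanSpace ℝ (Fin n) → HammingCube m) : Prop :=
  ∀ x ∈ sparseSphere n s, ∀ y ∈ sparseSphere n s,
    |hammingMetric (Φ x) (Φ y) - geodesicDist x y| ≤ δ

/-- The noisy sign-linear map `x ↦ sgn (A x + η)`, with `sgn` applied coordinatewise. -/
noncomputable def noisySignMap {n m : ℕ} (A : Matrix (Fin m) (Fin n) ℝ)
    (η : EuclideanSpace ℝ (Fin m)) (x : EuclideanSpace ℝ (Fin n)) : HammingCube m :=
  fun k => sgn ((A.mulVec x.ofLp) k + η k)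

/-- The `k`-th row of a matrix, as a Euclidean vector. -/
def rowVec {n m : ℕ} (A : Matrix (Fin m) (Fin n) ℝ) (k : Fin m) : EuclideanSpace ℝ (Fin n) :=
  WithLp.toLp 2 (A k)

/-- `A` has independent standard Gaussian rows, `η` is a centred Gaussian vector with covariance
`σ² I`, and `A` and `η` are independent. -/
structure IsGaussianModel {Ω : Type*} [MeasurableSpace Ω] (P : Measure Ω) {n m : ℕ}
    (A : Ω → Matrix (Fin m) (Fin n) ℝ) (η : Ω → EuclideanSpace ℝ (Fin m)) (σ : ℝ) : Prop where
  row_law : ∀ k : Fin m,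
    HasLaw (fun ω => rowVec (A ω) k) (stdGaussian (EuclideanSpace ℝ (Fin n))) P
  row_indep : iIndepFun (fun (k : Fin m) (ω : Ω) => rowVec (A ω) k) P
  noise_law : HasLaw η (multivariateGaussian 0 (σ ^ 2 • (1 : Matrix (Fin m) (Fin m) ℝ))) P
  indep : IndepFun (fun (ω : Ω) (k : Fin m) => rowVec (A ω) k) η P

/-- The property `p` holds with probability at least `q`: some measurable event of probability at
least `q` is contained in `p` (for measurable `p` this says `P p ≥ q`). -/
def HoldsWithProb {Ω : Type*} [MeasurableSpace Ω] (P : Measure Ω) (q : ℝ) (p : Ω → Prop) : Prop :=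
  ∃ E : Set Ω, MeasurableSet E ∧ ENNReal.ofReal q ≤ P E ∧ ∀ ω ∈ E, p ω

/-- The gap `δ + (1/π) arccos ((σ² - 1)/(σ² + 1)) - 1`. -/
noncomputable def gap (δ σ : ℝ) : ℝ :=
  δ + 1 / Real.pi * Real.arccos ((σ ^ 2 - 1) / (σ ^ 2 + 1)) - 1

end OneBit

/-! The Hamming distance between the images of x and y is the fraction of the m i.i.d. pairs (row,
noise) that fall in the symmetric difference of the half-spaces ⟨x,a⟩ + b > 0 and ⟨y,a⟩ + b > 0. The
RIP error therefore splits into a bias and a fluctuation that must be controlled uniformly in x and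
y.

Bias. The two measurements are centred Gaussians with correlation (⟨x,y⟩ + σ²)/(1 + σ²), so they
disagree in sign with probability arccos of this number over π (`rowLaw_symmDiff_halfSpace`). The
discrepancy with d(x,y) is largest at y = -x (`abs_bias_le`), and `gap δ σ` is the part of δ left
for the fluctuation.

Fluctuation. Half-spaces with normals supported on s fixed coordinates have VC dimension at most s +
2. A packing bound (`log_card_le_of_separated`) gives nets at scale 4⁻ʲ whose log-cardinality is
linear in j and independent of the sample size; the union over supports adds s log(en/s)
(`exists_hasNets_sparse`). Symmetrization and chaining of exponential moments
(`HasNets.exists_exp_bound`) then yield `measure_exists_deviation_le`. Chaining is what avoids the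
log m that a union bound over all sign patterns would cost. Rational half-spaces reduce the supremum
to a countable one. -/

namespace OneBit

/-! ### VC dimension, packing numbers and multiscale nets in the Hamming cube. -/

section Nets

open Finset
open scoped symmDiff

/-- For i ≤ d one has y ^ d ≤ y ^ i, so the binomial theorem bounds the left side by (1 + y) ^ k.
Leaving y free lets the packing argument tune it to the separation. -/
lemma sum_choose_mul_pow_le (k d : ℕ) {y : ℝ} (hy : 0 < y) (hy1 : y ≤ 1) :
    ((∑ i ∈ Iic d, k.choose i : ℕ) : ℝ) * y ^ d ≤ Real.exp (y * k) := by
  have h1 : ((∑ i ∈ Iic d, k.choose i : ℕ) : ℝ) * y ^ d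
      ≤ ∑ i ∈ Iic d, y ^ i * (k.choose i : ℝ) := by
    push_cast
    rw [Finset.sum_mul]
    refine Finset.sum_le_sum fun i hi => ?_
    rw [mul_comm]
    exact mul_le_mul_of_nonneg_right (pow_le_pow_of_le_one hy.le hy1 (mem_Iic.1 hi)) (by positivity)
  have h2 : ∑ i ∈ Iic d, y ^ i * (k.choose i : ℝ)
      ≤ ∑ i ∈ range (k + 1 + d), y ^ i * (k.choose i : ℝ) := by
    refine Finset.sum_le_sum_of_subset_of_nonneg (fun i hi => ?_) fun i _ _ => by positivity
    have := mem_Iic.1 hi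
    exact mem_range.2 (by omega)
  have h3 : ∑ i ∈ range (k + 1 + d), y ^ i * (k.choose i : ℝ) = (y + 1) ^ k := by
    rw [Finset.sum_range_add, add_pow]
    simp only [one_pow, mul_one]
    rw [add_eq_left]
    refine Finset.sum_eq_zero fun i _ => ?_
    rw [Nat.choose_eq_zero_of_lt (by omega)]
    simp
  have h4 : (y + 1) ^ k ≤ Real.exp (y * k) := by
    rw [mul_comm, Real.exp_nat_mul]
    exact pow_le_pow_left₀ (by linarith) (Real.add_one_le_exp y) k
  linarith

variable {I : Type*} [DecidableEq I]

/-- Indices with the same image under `p` cannot be told apart, so `p` is injective on a shattered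
set and carries it to a shattered set. -/
lemma vcDim_image_preimage_le {k : ℕ} (p : Fin k → I) (𝒜 : Finset (Finset I)) :
    (𝒜.image fun A => univ.filter fun i => p i ∈ A).vcDim ≤ 𝒜.vcDim := by
  unfold vcDim
  refine Finset.sup_le fun s hs => ?_
  rw [mem_shatterer] at hs
  have hinj : Set.InjOn p s := by
    intro a ha b hb hab
    obtain ⟨u, hu, hua⟩ := hs.exists_inter_eq_singleton ha
    obtain ⟨A, _, rfl⟩ := mem_image.1 hu
    have h1 : a ∈ s ∩ univ.filter fun i => p i ∈ A := by rw [hua]; simp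
    have h2 : b ∈ s ∩ univ.filter fun i => p i ∈ A := by
      simp only [mem_inter, mem_filter, mem_univ, true_and] at h1 ⊢
      exact ⟨hb, hab ▸ h1.2⟩
    rw [hua] at h2
    exact (mem_singleton.1 h2).symm
  have hsh : 𝒜.Shatters (s.image p) := by
    intro t ht
    obtain ⟨u, hu, hut⟩ := hs (t := s.filter fun i => p i ∈ t) (filter_subset _ _)
    obtain ⟨A, hA, rfl⟩ := mem_image.1 hu
    refine ⟨A, hA, ?_⟩
    ext x
    constructor
    · intro hx
      obtain ⟨hx1, hx2⟩ := mem_inter.1 hx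
      obtain ⟨i, hi, rfl⟩ := mem_image.1 hx1
      have : i ∈ s ∩ univ.filter fun i => p i ∈ A := by simp [hi, hx2]
      rw [hut] at this
      exact (mem_filter.1 this).2
    · intro hx
      obtain ⟨i, hi, rfl⟩ := mem_image.1 (ht hx)
      have : i ∈ s.filter fun i => p i ∈ t := mem_filter.2 ⟨hi, hx⟩
      rw [← hut] at this
      simp only [mem_inter, mem_filter, mem_univ, true_and] at this
      exact mem_inter.2 ⟨ht hx, this.2⟩
  rw [← card_image_of_injOn hinj]
  exact Finset.le_sup (f := card) (mem_shatterer.2 hsh)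

variable [Fintype I]

/-- A separated family is injectively traced on some short tuple of points. -/
lemma exists_separating_tuple (𝒬 : Finset (Finset I)) {r : ℝ} (hr : r ≤ 1)
    (hsep : ∀ A ∈ 𝒬, ∀ B ∈ 𝒬, A ≠ B → r * Fintype.card I ≤ #(A ∆ B)) (hN : 0 < Fintype.card I)
    (k : ℕ) (hk : (#𝒬 : ℝ) ^ 2 * Real.exp (-(r * k)) < 1) :
    ∃ p : Fin k → I, Set.InjOn (fun A : Finset I => univ.filter fun i => p i ∈ A) 𝒬 := by
  by_contra! hcon
  set N := Fintype.card I with hNdef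
  -- Probabilistic method by counting: a bad tuple misses some `A ∆ B` entirely. At most (#𝒬)²
  -- pairs, each missed by at most ((1 - r)N)^k tuples, cannot account for all N^k tuples.
  have hcover : (univ : Finset (Fin k → I)) ⊆
      ((𝒬 ×ˢ 𝒬).filter fun q => q.1 ≠ q.2).biUnion
        fun q => Fintype.piFinset fun _ : Fin k => (q.1 ∆ q.2)ᶜ := by
    intro p _
    have := hcon p
    simp only [Set.InjOn] at this
    push Not at this
    obtain ⟨A, hA, B, hB, hAB, hne⟩ := this
    refine mem_biUnion.2 ⟨(A, B), by simp [mem_coe.1 hA, mem_coe.1 hB, hne], ?_⟩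
    rw [Fintype.mem_piFinset]
    intro i
    have := congrArg (fun s => i ∈ s) hAB
    simp only [mem_filter, mem_univ, true_and, eq_iff_iff] at this
    rw [mem_compl, mem_symmDiff]
    tauto
  have h1 := card_le_card hcover
  rw [card_univ, Fintype.card_fun, Fintype.card_fin] at h1
  have h2 : (N : ℝ) ^ k ≤ ∑ q ∈ (𝒬 ×ˢ 𝒬).filter (fun q => q.1 ≠ q.2),
      ((1 - r) * N) ^ k := by
    calc (N : ℝ) ^ k ≤ ∑ q ∈ (𝒬 ×ˢ 𝒬).filter (fun q => q.1 ≠ q.2),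
          ((Fintype.piFinset fun _ : Fin k => (q.1 ∆ q.2)ᶜ).card : ℝ) := by
          exact_mod_cast h1.trans card_biUnion_le
      _ ≤ _ := by
          refine Finset.sum_le_sum fun q hq => ?_
          simp only [mem_filter, mem_product] at hq
          rw [Fintype.card_piFinset_const, Nat.cast_pow]
          refine pow_le_pow_left₀ (by positivity) ?_ k
          have h3 := hsep _ hq.1.1 _ hq.1.2 hq.2
          rw [card_compl, Nat.cast_sub (card_le_univ _)]
          linarith
  rw [Finset.sum_const, nsmul_eq_mul] at h2
  have h3 : (#((𝒬 ×ˢ 𝒬).filter (fun q => q.1 ≠ q.2)) : ℝ) ≤ (#𝒬 : ℝ) ^ 2 := by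
    rw [sq]
    exact_mod_cast (card_filter_le _ _).trans_eq (card_product _ _)
  have hNk : (0 : ℝ) < (N : ℝ) ^ k := by positivity
  have h4 : (1 - r) ^ k ≤ Real.exp (-(r * k)) := by
    rw [show -(r * (k : ℝ)) = k * (-r) by ring, Real.exp_nat_mul]
    refine pow_le_pow_left₀ (by linarith) ?_ k
    linarith [Real.add_one_le_exp (-r)]
  have h5 : (0 : ℝ) ≤ (1 - r) ^ k := pow_nonneg (by linarith) k
  rw [mul_pow] at h2
  have h6 : (#((𝒬 ×ˢ 𝒬).filter (fun q => q.1 ≠ q.2)) : ℝ) * (1 - r) ^ k < 1 :=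
    (mul_le_mul h3 h4 h5 (by positivity)).trans_lt hk
  nlinarith

/-- Let K = #𝒬. About 2 log K / r points suffice to keep all traces distinct, so the Sauer–Shelah
lemma bounds K on a sample whose size depends on K but not on `I`. With y = r / 4 the factor
exp(rk/4) is about √K, so half of log K is absorbed on the left. -/
lemma log_card_le_of_separated (𝒬 : Finset (Finset I)) {d : ℕ} (hd : 1 ≤ d) (hvc : 𝒬.vcDim ≤ d)
    {r : ℝ} (hr0 : 0 < r) (hr : r ≤ 1)
    (hsep : ∀ A ∈ 𝒬, ∀ B ∈ 𝒬, A ≠ B → r * Fintype.card I ≤ #(A ∆ B)) :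
    Real.log #𝒬 ≤ 3 * d * Real.log (4 / r) := by
  have hd' : (1 : ℝ) ≤ d := by exact_mod_cast hd
  have hlog4 : 1 ≤ Real.log (4 / r) := by
    rw [Real.le_log_iff_exp_le (by positivity), le_div_iff₀ hr0]
    nlinarith [Real.exp_one_lt_d9, Real.exp_pos 1]
  rcases le_or_gt (#𝒬) 1 with h1 | h1
  · have : Real.log #𝒬 ≤ 0 := Real.log_nonpos (by positivity) (by exact_mod_cast h1)
    have : 0 ≤ 3 * d * Real.log (4 / r) := by positivity
    linarith
  have hN : 0 < Fintype.card I := by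
    rw [Fintype.card_pos_iff]
    by_contra hI
    rw [not_nonempty_iff] at hI
    have : #𝒬 ≤ 1 := card_le_one.2 fun a _ b _ => by
      ext i; exact (hI.false i).elim
    omega
  set K : ℝ := ((#𝒬 : ℕ) : ℝ) with hK
  have hK1 : (1 : ℝ) < K := by rw [hK]; exact_mod_cast h1
  have hK0 : 0 < K := by linarith
  have hlK : 0 < Real.log K := Real.log_pos hK1
  set k : ℕ := ⌊2 * Real.log K / r⌋₊ + 1 with hkdef
  have hk1 : 2 * Real.log K < r * k := by
    have := Nat.lt_floor_add_one (2 * Real.log K / r)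
    rw [div_lt_iff₀ hr0] at this
    rw [hkdef]; push_cast; linarith
  have hk2 : r * k ≤ 2 * Real.log K + r := by
    have := Nat.floor_le (a := 2 * Real.log K / r) (by positivity)
    rw [le_div_iff₀ hr0] at this
    rw [hkdef]; push_cast; linarith
  obtain ⟨p, hp⟩ := exists_separating_tuple 𝒬 hr hsep hN k (by
    rw [← hK, ← Real.exp_log hK0, ← Real.exp_nat_mul, ← Real.exp_add, Real.exp_lt_one_iff]
    push_cast; linarith)
  have h2 : #𝒬 ≤ ∑ i ∈ Iic d, k.choose i := by
    rw [← card_image_of_injOn hp]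
    refine (card_le_card_shatterer _).trans (card_shatterer_le_sum_vcDim.trans ?_)
    rw [Fintype.card_fin]
    exact Finset.sum_le_sum_of_subset
      (Iic_subset_Iic.2 ((vcDim_image_preimage_le p 𝒬).trans hvc))
  have h3 := sum_choose_mul_pow_le k d (y := r / 4) (by positivity) (by linarith)
  have h4 : K * (r / 4) ^ d ≤ Real.exp (r / 4 * k) :=
    (mul_le_mul_of_nonneg_right (by rw [hK]; exact_mod_cast h2) (by positivity)).trans h3
  have h5 := Real.log_le_log (by positivity) h4
  rw [Real.log_exp, Real.log_mul hK0.ne' (by positivity), Real.log_pow,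
    show Real.log (r / 4) = -Real.log (4 / r) by rw [← inv_div, Real.log_inv]] at h5
  have h6 : 1 ≤ d * Real.log (4 / r) := one_le_mul_of_one_le_of_one_le hd' hlog4
  linarith

/-- `𝒜` has, at every scale `4⁻ʲ`, a net of cardinality at most `exp (D (j + 1))` for the normalized
Hamming distance. -/
def HasNets (𝒜 : Finset (Finset I)) (D : ℝ) : Prop :=
  ∀ j : ℕ, ∃ 𝒩 : Finset (Finset I), (#𝒩 : ℝ) ≤ Real.exp (D * (j + 1)) ∧
    ∀ A ∈ 𝒜, ∃ B ∈ 𝒩, (#(A ∆ B) : ℝ) * 4 ^ j ≤ Fintype.card I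

/-- A separated subfamily of maximal cardinality is a net, as any point far from it could be added.
-/
lemma exists_maximal_separated (𝒜 : Finset (Finset I)) (t : ℝ) :
    ∃ 𝒬 ⊆ 𝒜, (∀ A ∈ 𝒬, ∀ B ∈ 𝒬, A ≠ B → t ≤ #(A ∆ B)) ∧
      ∀ A ∈ 𝒜, ∃ B ∈ 𝒬, A = B ∨ (#(A ∆ B) : ℝ) ≤ t := by
  classical
  obtain ⟨𝒬, h𝒬, hmax⟩ := exists_max_image
    (𝒜.powerset.filter fun 𝒬 => ∀ A ∈ 𝒬, ∀ B ∈ 𝒬, A ≠ B → t ≤ #(A ∆ B)) card ⟨∅, by simp⟩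
  rw [mem_filter, mem_powerset] at h𝒬
  refine ⟨𝒬, h𝒬.1, h𝒬.2, fun A hA => ?_⟩
  by_contra! hcon
  have hA𝒬 : A ∉ 𝒬 := fun h => (hcon A h).1 rfl
  have := hmax (insert A 𝒬) (by
    rw [mem_filter, mem_powerset]
    refine ⟨insert_subset hA h𝒬.1, ?_⟩
    intro B hB C hC hBC
    rcases mem_insert.1 hB with rfl | hB' <;> rcases mem_insert.1 hC with rfl | hC'
    · exact absurd rfl hBC
    · exact (hcon _ hC').2.le
    · rw [symmDiff_comm]; exact (hcon _ hB').2.le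
    · exact h𝒬.2 _ hB' _ hC' hBC)
  rw [card_insert_of_notMem hA𝒬] at this
  omega

/-- The packing bound at r = 4⁻ʲ has log(4/r) = (j + 1) log 4, which is where the linear growth in j
+ 1 comes from; 3 log 4 < 5. -/
lemma HasNets.of_vcDim_le {𝒜 : Finset (Finset I)} {d : ℕ} (hd : 1 ≤ d) (hvc : 𝒜.vcDim ≤ d) :
    HasNets 𝒜 (5 * d) := by
  intro j
  obtain ⟨𝒬, hsub, hsep, hnet⟩ := exists_maximal_separated 𝒜 ((4 ^ j)⁻¹ * Fintype.card I)
  refine ⟨𝒬, ?_, fun A hA => ?_⟩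
  · have h := log_card_le_of_separated 𝒬 hd ((vcDim_mono hsub).trans hvc)
      (r := (4 ^ j)⁻¹) (by positivity) (inv_le_one_of_one_le₀ (one_le_pow₀ (by norm_num))) hsep
    have h4 : Real.log (4 / (4 ^ j)⁻¹) ≤ (j + 1) * (3 / 2) := by
      rw [div_inv_eq_mul, ← pow_succ', Real.log_pow, show (4 : ℝ) = 2 ^ 2 by norm_num, Real.log_pow]
      push_cast
      have := Real.log_two_lt_d9
      gcongr
      linarith
    have h5 : Real.log #𝒬 ≤ 5 * d * (j + 1) := by
      refine h.trans ((mul_le_mul_of_nonneg_left h4 (by positivity)).trans ?_)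
      have : (0 : ℝ) ≤ d * (j + 1) := by positivity
      nlinarith
    exact (Real.le_exp_log _).trans (Real.exp_le_exp.2 h5)
  · obtain ⟨B, hB, h | h⟩ := hnet A hA
    · exact ⟨B, hB, by simp [h]⟩
    · refine ⟨B, hB, ?_⟩
      rw [← div_eq_inv_mul, le_div_iff₀ (by positivity)] at h
      exact h

lemma HasNets.mono {𝒜 ℬ : Finset (Finset I)} {D D' : ℝ} (h : HasNets 𝒜 D) (hℬ : ℬ ⊆ 𝒜)
    (hD : D ≤ D') : HasNets ℬ D' := by
  intro j
  obtain ⟨𝒩, h1, h2⟩ := h j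
  exact ⟨𝒩, h1.trans (Real.exp_le_exp.2 (by gcongr)), fun A hA => h2 A (hℬ hA)⟩

lemma HasNets.biUnion {κ : Type*} (T : Finset κ) (𝒜 : κ → Finset (Finset I)) {D E : ℝ}
    (hE : 0 ≤ E) (hT : (#T : ℝ) ≤ Real.exp E) (h : ∀ t ∈ T, HasNets (𝒜 t) D) :
    HasNets (T.biUnion 𝒜) (D + E) := by
  classical
  intro j
  choose! 𝒩 h1 h2 using fun t ht => h t ht j
  refine ⟨T.biUnion 𝒩, ?_, fun A hA => ?_⟩
  · calc (#(T.biUnion 𝒩) : ℝ) ≤ ∑ t ∈ T, (#(𝒩 t) : ℝ) := by exact_mod_cast card_biUnion_le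
      _ ≤ ∑ t ∈ T, Real.exp (D * (j + 1)) := Finset.sum_le_sum fun t ht => h1 t ht
      _ = #T * Real.exp (D * (j + 1)) := by rw [Finset.sum_const, nsmul_eq_mul]
      _ ≤ Real.exp E * Real.exp (D * (j + 1)) := by gcongr
      _ ≤ Real.exp ((D + E) * (j + 1)) := by
          rw [← Real.exp_add, Real.exp_le_exp]
          have : (0 : ℝ) ≤ E * j := by positivity
          nlinarith
  · obtain ⟨t, ht, hAt⟩ := mem_biUnion.1 hA
    obtain ⟨B, hB, h3⟩ := h2 t ht A hAt
    exact ⟨B, mem_biUnion.2 ⟨t, ht, hB⟩, h3⟩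

lemma card_symmDiff_symmDiff_le (A B A' B' : Finset I) :
    #((A ∆ B) ∆ (A' ∆ B')) ≤ #(A ∆ A') + #(B ∆ B') := by
  rw [symmDiff_symmDiff_symmDiff_comm]
  exact (card_le_card symmDiff_le_sup).trans (card_union_le _ _)

/-- Approximating both arguments at scale j + 1 leaves a total error 2 · 4⁻⁽ʲ⁺¹⁾ < 4⁻ʲ; the entropy
becomes 2D(j + 2) ≤ 4D(j + 1). -/
lemma HasNets.symmDiff {𝒜 : Finset (Finset I)} {D : ℝ} (hD : 0 ≤ D) (h : HasNets 𝒜 D) :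
    HasNets (image₂ (· ∆ ·) 𝒜 𝒜) (4 * D) := by
  intro j
  obtain ⟨𝒩, h1, h2⟩ := h (j + 1)
  refine ⟨image₂ (· ∆ ·) 𝒩 𝒩, ?_, fun A hA => ?_⟩
  · calc (#(image₂ (· ∆ ·) 𝒩 𝒩) : ℝ) ≤ (#𝒩 : ℝ) * #𝒩 := by
          exact_mod_cast card_image₂_le _ _ _
      _ ≤ Real.exp (D * ((j + 1 : ℕ) + 1)) * Real.exp (D * ((j + 1 : ℕ) + 1)) := by gcongr
      _ ≤ _ := by
          rw [← Real.exp_add, Real.exp_le_exp]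
          push_cast
          have : (0 : ℝ) ≤ D * j := by positivity
          nlinarith
  · obtain ⟨A₁, hA₁, A₂, hA₂, rfl⟩ := mem_image₂.1 hA
    obtain ⟨B₁, hB₁, h3⟩ := h2 A₁ hA₁
    obtain ⟨B₂, hB₂, h4⟩ := h2 A₂ hA₂
    refine ⟨B₁ ∆ B₂, mem_image₂_of_mem hB₁ hB₂, ?_⟩
    have h5 : (#((A₁ ∆ A₂) ∆ (B₁ ∆ B₂)) : ℝ) ≤ #(A₁ ∆ B₁) + #(A₂ ∆ B₂) := by
      exact_mod_cast card_symmDiff_symmDiff_le _ _ _ _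
    rw [pow_succ] at h3 h4
    have h6 := mul_le_mul_of_nonneg_right h5 (show (0 : ℝ) ≤ 4 ^ j by positivity)
    have h7 : (0 : ℝ) ≤ #(A₁ ∆ B₁) * 4 ^ j := by positivity
    have h8 : (0 : ℝ) ≤ #(A₂ ∆ B₂) * 4 ^ j := by positivity
    linarith

end Nets

/-! ### Exponential moments of the supremum of a Rademacher process. -/

section Chaining

open Finset
open scoped symmDiff

variable {κ : Type*} [Fintype κ] [DecidableEq κ]

/-- The sign attached to a coin flip. -/
def coin (b : Bool) : ℝ := if b then -1 else 1

/-- The difference between the indicators of the two copies of `k` in `A`. -/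
noncomputable def copyDiff (A : Finset (κ × Bool)) (k : κ) : ℝ :=
  (if (k, false) ∈ A then 1 else 0) - (if (k, true) ∈ A then 1 else 0)

/-- The Rademacher process indexed by sets of points taken from two copies of `κ`. -/
noncomputable def rademacher (A : Finset (κ × Bool)) (ε : κ → Bool) : ℝ :=
  ∑ k, coin (ε k) * copyDiff A k

/-- The sum over coin flips factorizes, and cosh v ≤ exp(v² / 2) for each factor. -/
lemma sum_exp_coin_le (v : κ → ℝ) :
    ∑ ε : κ → Bool, Real.exp (∑ k, coin (ε k) * v k)
      ≤ 2 ^ Fintype.card κ * Real.exp ((∑ k, v k ^ 2) / 2) := by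
  have h1 : ∑ ε : κ → Bool, Real.exp (∑ k, coin (ε k) * v k)
      = ∏ k, ∑ b : Bool, Real.exp (coin b * v k) := by
    rw [Finset.prod_univ_sum, Fintype.piFinset_univ]
    simp only [Real.exp_sum]
  rw [h1]
  calc ∏ k, ∑ b : Bool, Real.exp (coin b * v k)
      ≤ ∏ k, 2 * Real.exp (v k ^ 2 / 2) := by
        refine Finset.prod_le_prod (fun k _ => by positivity) fun k _ => ?_
        have := Real.cosh_le_exp_half_sq (v k)
        rw [Real.cosh_eq] at this
        simp only [coin, Fintype.sum_bool, if_true, Bool.false_eq_true, if_false, one_mul,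
          neg_one_mul]
        linarith
    _ = _ := by
        rw [Finset.prod_mul_distrib, ← Real.exp_sum, Finset.sum_div]
        simp

/-- The factor 2 is attained when both copies of `k` change and their differences add up: the square
is 4, for two elements of `A ∆ B`. -/
lemma sum_sq_copyDiff_sub_le (A B : Finset (κ × Bool)) :
    ∑ k, (copyDiff A k - copyDiff B k) ^ 2 ≤ 2 * #(A ∆ B) := by
  have h : (#(A ∆ B) : ℝ) = ∑ k : κ, ∑ b : Bool, if (k, b) ∈ A ∆ B then (1 : ℝ) else 0 := by
    rw [← Fintype.sum_prod_type' (f := fun (k : κ) (b : Bool) =>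
      if (k, b) ∈ A ∆ B then (1 : ℝ) else 0)]
    simp
  rw [h, Finset.mul_sum]
  refine Finset.sum_le_sum fun k _ => ?_
  simp only [copyDiff, Fintype.sum_bool, mem_symmDiff]
  by_cases h1 : (k, false) ∈ A <;> by_cases h2 : (k, true) ∈ A <;>
    by_cases h3 : (k, false) ∈ B <;> by_cases h4 : (k, true) ∈ B <;> simp [h1, h2, h3, h4] <;>
    norm_num

lemma rademacher_sub (A B : Finset (κ × Bool)) (ε : κ → Bool) :
    rademacher A ε - rademacher B ε = ∑ k, coin (ε k) * (copyDiff A k - copyDiff B k) := by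
  simp only [rademacher, mul_sub, Finset.sum_sub_distrib]

lemma rademacher_empty (ε : κ → Bool) : rademacher ∅ ε = 0 := by
  simp [rademacher, copyDiff]

lemma sum_exp_abs_rademacher_sub_le (A B : Finset (κ × Bool)) (t : ℝ) :
    ∑ ε : κ → Bool, Real.exp (t * |rademacher A ε - rademacher B ε|)
      ≤ 2 ^ Fintype.card κ * (2 * Real.exp (t ^ 2 * #(A ∆ B))) := by
  have key : ∀ s : ℝ, s ^ 2 = t ^ 2 → ∑ ε : κ → Bool,
      Real.exp (s * (rademacher A ε - rademacher B ε))
      ≤ 2 ^ Fintype.card κ * Real.exp (t ^ 2 * #(A ∆ B)) := by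
    intro s hs
    have h := sum_exp_coin_le fun k => s * (copyDiff A k - copyDiff B k)
    simp only [mul_pow, ← Finset.mul_sum, hs] at h
    have h2 : ∀ ε : κ → Bool, s * (rademacher A ε - rademacher B ε)
        = ∑ k, coin (ε k) * (s * (copyDiff A k - copyDiff B k)) := by
      intro ε
      rw [rademacher_sub, Finset.mul_sum]
      exact Finset.sum_congr rfl fun k _ => by ring
    simp only [h2]
    refine h.trans ?_
    gcongr
    have := mul_le_mul_of_nonneg_left (sum_sq_copyDiff_sub_le A B) (sq_nonneg t)
    linarith
  calc ∑ ε : κ → Bool, Real.exp (t * |rademacher A ε - rademacher B ε|)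
      ≤ ∑ ε : κ → Bool, (Real.exp (t * (rademacher A ε - rademacher B ε))
          + Real.exp (-t * (rademacher A ε - rademacher B ε))) := by
        refine Finset.sum_le_sum fun ε _ => ?_
        rcases abs_cases (rademacher A ε - rademacher B ε) with ⟨h, _⟩ | ⟨h, _⟩ <;> rw [h]
        · exact le_add_of_nonneg_right (Real.exp_pos _).le
        · rw [mul_neg, neg_mul]
          exact le_add_of_nonneg_left (Real.exp_pos _).le
    _ ≤ _ := by
        rw [Finset.sum_add_distrib]
        have h1 := key t rfl
        have h2 := key (-t) (neg_sq t)
        linarith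

/-- Convexity of exp with weights 1/2, 1/4, ..., the leftover weight 2⁻ᴶ sitting at 0. It turns the
exponential of a chain into a sum over levels, where each level can be bounded by all of its links
at once. -/
lemma exp_sum_geometric_le (J : ℕ) (y : ℕ → ℝ) :
    Real.exp (∑ j ∈ range J, (2 ^ (j + 1))⁻¹ * y j)
      ≤ (2 ^ J)⁻¹ + ∑ j ∈ range J, (2 ^ (j + 1))⁻¹ * Real.exp (y j) := by
  induction J generalizing y with
  | zero => simp
  | succ J ih =>
    have h1 : ∀ z : ℕ → ℝ, ∑ j ∈ range (J + 1), (2 ^ (j + 1))⁻¹ * z j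
        = 1 / 2 * (∑ j ∈ range J, (2 ^ (j + 1))⁻¹ * z (j + 1)) + 1 / 2 * z 0 := by
      intro z
      rw [Finset.sum_range_succ', Finset.mul_sum]
      congr 1
      · refine Finset.sum_congr rfl fun j _ => ?_
        rw [pow_succ 2 (j + 1), mul_inv]; ring
      · norm_num
    rw [h1 y, h1 fun j => Real.exp (y j)]
    have h2 := convexOn_exp.2 (Set.mem_univ (∑ j ∈ range J, (2 ^ (j + 1))⁻¹ * y (j + 1)))
      (Set.mem_univ (y 0)) (show (0 : ℝ) ≤ 1 / 2 by norm_num) (show (0 : ℝ) ≤ 1 / 2 by norm_num)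
      (by norm_num)
    simp only [smul_eq_mul] at h2
    have h3 := ih fun j => y (j + 1)
    have h4 : ((2 : ℝ) ^ (J + 1))⁻¹ = 1 / 2 * (2 ^ J)⁻¹ := by rw [pow_succ, mul_inv]; ring
    rw [h4]
    linarith

lemma sum_geometric_linear (J : ℕ) :
    ∑ j ∈ range J, ((2 : ℝ) ^ (j + 1))⁻¹ * (2 * j + 3) = 5 - (2 * J + 5) * (2 ^ J)⁻¹ := by
  induction J with
  | zero => norm_num
  | succ J ih =>
    rw [Finset.sum_range_succ, ih, pow_succ, mul_inv]
    push_cast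
    ring

lemma sum_geometric_le_one (J : ℕ) : ∑ j ∈ range J, ((2 : ℝ) ^ (j + 1))⁻¹ ≤ 1 := by
  have : ∑ j ∈ range J, ((2 : ℝ) ^ (j + 1))⁻¹ = 1 - (2 ^ J)⁻¹ := by
    induction J with
    | zero => norm_num
    | succ J ih => rw [Finset.sum_range_succ, ih, pow_succ, mul_inv]; ring
  rw [this]
  have : (0 : ℝ) < (2 ^ J)⁻¹ := by positivity
  linarith

/-- Nets extended by the trivial net `{∅}` at scale `1`, with chains of near points. -/
lemma HasNets.exists_chains {I : Type*} [DecidableEq I] [Fintype I] {𝒜 : Finset (Finset I)} {D : ℝ}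
    (h : HasNets 𝒜 D) (hD : 0 ≤ D) :
    ∃ net : ℕ → Finset (Finset I), (∀ j, (#(net j) : ℝ) ≤ Real.exp (D * (j + 1))) ∧
      ∀ A ∈ 𝒜, ∃ B : ℕ → Finset I, B 0 = ∅ ∧ B (Fintype.card I) = A ∧ (∀ j, B j ∈ net j) ∧
        ∀ j, (#(B (j + 1) ∆ B j) : ℝ) * 4 ^ j ≤ 5 / 4 * Fintype.card I := by
  choose 𝒩 h1 h2 using h
  refine ⟨fun j => if j = 0 then {∅} else 𝒩 j, fun j => ?_, fun A hA => ?_⟩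
  · by_cases hj : j = 0
    · simp [hj, hD]
    · simpa [hj] using h1 j
  · choose B hB h3 using fun j => h2 j A hA
    set B' : ℕ → Finset I := fun j => if j = 0 then ∅ else B j with hB'
    have hclose : ∀ j, (#(A ∆ B' j) : ℝ) * 4 ^ j ≤ Fintype.card I := by
      intro j
      by_cases hj : j = 0
      · simp only [hB', hj, if_true, symmDiff_bot, ← bot_eq_empty, pow_zero, mul_one]
        exact_mod_cast card_le_univ A
      · simpa [hB', hj] using h3 j
    refine ⟨B', by simp [hB'], ?_, fun j => ?_, fun j => ?_⟩
    · have h4 := hclose (Fintype.card I)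
      have h5 : #(A ∆ B' (Fintype.card I)) = 0 := by
        by_contra h0
        have h6 : (1 : ℝ) ≤ #(A ∆ B' (Fintype.card I)) := by
          exact_mod_cast Nat.one_le_iff_ne_zero.2 h0
        have h7 : (Fintype.card I : ℝ) < 4 ^ Fintype.card I := by
          exact_mod_cast Nat.lt_pow_self (by norm_num)
        nlinarith
      rw [card_eq_zero, ← bot_eq_empty, symmDiff_eq_bot] at h5
      exact h5.symm
    · by_cases hj : j = 0
      · simp [hB', hj]
      · simpa [hB', hj] using hB j
    · have h4 := hclose j
      have h5 := hclose (j + 1)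
      have h6 : #(B' (j + 1) ∆ B' j) ≤ #(A ∆ B' (j + 1)) + #(A ∆ B' j) := by
        rw [symmDiff_comm A (B' (j + 1))]
        exact (card_le_card (symmDiff_triangle _ A _)).trans (card_union_le _ _)
      have h7 : (#(B' (j + 1) ∆ B' j) : ℝ) ≤ #(A ∆ B' (j + 1)) + #(A ∆ B' j) := by
        exact_mod_cast h6
      rw [pow_succ] at h5
      have h8 := mul_le_mul_of_nonneg_right h7 (show (0 : ℝ) ≤ 4 ^ j by positivity)
      linarith

/-- Chaining bound for the exponential moment of the supremum of the Rademacher process. -/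
theorem HasNets.exists_exp_bound {𝒜 : Finset (Finset (κ × Bool))} {D : ℝ} (h : HasNets 𝒜 D)
    (hD : 0 ≤ D) {l : ℝ} (hl : 0 ≤ l) :
    ∃ S : (κ → Bool) → ℝ, (∀ ε, ∀ A ∈ 𝒜, Real.exp (l * |rademacher A ε|) ≤ S ε) ∧
      ∑ ε, S ε ≤ 2 ^ Fintype.card κ *
        (3 * Real.exp (5 * D + 10 * l ^ 2 * Fintype.card κ)) := by
  obtain ⟨net, hnet, hchain⟩ := h.exists_chains hD
  have hcard : (Fintype.card (κ × Bool) : ℝ) = 2 * Fintype.card κ := by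
    rw [Fintype.card_prod, Fintype.card_bool]; push_cast; ring
  set J := Fintype.card (κ × Bool) with hJ
  -- The constant 5/4 is 1 + 1/4, the triangle inequality between consecutive scales.
  set links : ℕ → Finset (Finset (κ × Bool) × Finset (κ × Bool)) := fun j =>
    (net (j + 1) ×ˢ net j).filter fun q => (#(q.1 ∆ q.2) : ℝ) * 4 ^ j ≤ 5 / 4 * J with hlinks
  -- The factor 2^(j+1) undoes the convexity weight, and D(2j + 3) = D(j + 2) + D(j + 1) bounds the
  -- log of the number of links at level j, so every level contributes the same amount.
  set g : ℕ → Finset (κ × Bool) × Finset (κ × Bool) → (κ → Bool) → ℝ := fun j q ε =>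
    Real.exp (l * 2 ^ (j + 1) * |rademacher q.1 ε - rademacher q.2 ε| - D * (2 * j + 3)) with hg
  refine ⟨fun ε => Real.exp (5 * D) *
    (1 + ∑ j ∈ range J, (2 ^ (j + 1))⁻¹ * ∑ q ∈ links j, g j q ε), fun ε A hA => ?_, ?_⟩
  · obtain ⟨B, hB0, hBJ, hBnet, hBclose⟩ := hchain A hA
    have h1 : |rademacher A ε| ≤ ∑ j ∈ range J, |rademacher (B (j + 1)) ε - rademacher (B j) ε| := by
      have h2 := Finset.sum_range_sub (fun j => rademacher (B j) ε) J
      rw [hB0, hBJ, rademacher_empty, sub_zero] at h2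
      rw [← h2]
      exact Finset.abs_sum_le_sum_abs _ _
    set y : ℕ → ℝ := fun j =>
      l * 2 ^ (j + 1) * |rademacher (B (j + 1)) ε - rademacher (B j) ε| - D * (2 * j + 3) with hy
    have h2 : l * |rademacher A ε| ≤ 5 * D + ∑ j ∈ range J, (2 ^ (j + 1))⁻¹ * y j := by
      have h3 : ∑ j ∈ range J, (2 ^ (j + 1))⁻¹ * y j
          = l * ∑ j ∈ range J, |rademacher (B (j + 1)) ε - rademacher (B j) ε|
            - D * ∑ j ∈ range J, ((2 : ℝ) ^ (j + 1))⁻¹ * (2 * j + 3) := by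
        rw [Finset.mul_sum, Finset.mul_sum, ← Finset.sum_sub_distrib]
        refine Finset.sum_congr rfl fun j _ => ?_
        simp only [hy]
        field_simp
      rw [h3, sum_geometric_linear]
      have h4 := mul_le_mul_of_nonneg_left h1 hl
      have h5 : 0 ≤ D * ((2 * J + 5) * ((2 : ℝ) ^ J)⁻¹) := by positivity
      linarith
    calc Real.exp (l * |rademacher A ε|)
        ≤ Real.exp (5 * D) * Real.exp (∑ j ∈ range J, (2 ^ (j + 1))⁻¹ * y j) := by
          rw [← Real.exp_add]; exact Real.exp_le_exp.2 h2
      _ ≤ Real.exp (5 * D) *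
          ((2 ^ J)⁻¹ + ∑ j ∈ range J, (2 ^ (j + 1))⁻¹ * Real.exp (y j)) := by
          gcongr; exact exp_sum_geometric_le J y
      _ ≤ _ := by
          refine mul_le_mul_of_nonneg_left (add_le_add ?_ (Finset.sum_le_sum fun j _ =>
            mul_le_mul_of_nonneg_left ?_ (by positivity))) (Real.exp_pos _).le
          · exact inv_le_one_of_one_le₀ (one_le_pow₀ (by norm_num))
          · exact Finset.single_le_sum (f := fun q => g j q ε) (a := (B (j + 1), B j))
              (fun q _ => (Real.exp_pos _).le)
              (mem_filter.2 ⟨mem_product.2 ⟨hBnet _, hBnet _⟩, hBclose j⟩)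
  · set M : ℝ := 2 ^ Fintype.card κ with hM
    have hM0 : 0 < M := by positivity
    set E : ℝ := Real.exp (10 * l ^ 2 * Fintype.card κ) with hE
    have hE1 : 1 ≤ E := Real.one_le_exp (by positivity)
    have hlink : ∀ j, ∀ q ∈ links j, ∑ ε, g j q ε ≤ Real.exp (-(D * (2 * j + 3))) * (M * (2 * E)) := by
      intro j q hq
      have hq2 := (mem_filter.1 hq).2
      simp only [hg, sub_eq_add_neg, Real.exp_add, mul_comm _ (Real.exp (-(D * (2 * (j : ℝ) + 3))))]
      rw [← Finset.mul_sum]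
      gcongr
      refine (sum_exp_abs_rademacher_sub_le q.1 q.2 (l * 2 ^ (j + 1))).trans ?_
      gcongr
      -- The growth 4^j of the squared multiplier cancels the decay of the link lengths, leaving 4l²
      -- · (5/4) · 2 `Fintype.card κ`, whence the constant 10.
      have h1 : (l * 2 ^ (j + 1)) ^ 2 * (#(q.1 ∆ q.2) : ℝ)
          = 4 * l ^ 2 * (#(q.1 ∆ q.2) * 4 ^ j) := by
        rw [show (4 : ℝ) = 2 ^ 2 by norm_num, ← pow_mul]; ring
      rw [h1]
      have h2 := mul_le_mul_of_nonneg_left hq2 (show 0 ≤ 4 * l ^ 2 by positivity)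
      rw [hcard] at h2
      rw [hE, Real.exp_le_exp]
      linarith
    have hlevel : ∀ j, ∑ q ∈ links j, ∑ ε, g j q ε ≤ M * (2 * E) := by
      intro j
      refine (Finset.sum_le_sum fun q hq => hlink j q hq).trans ?_
      rw [Finset.sum_const, nsmul_eq_mul, ← mul_assoc]
      refine mul_le_of_le_one_left (by positivity) ?_
      have h1 : (#(links j) : ℝ) ≤ Real.exp (D * (2 * j + 3)) := by
        calc (#(links j) : ℝ) ≤ #(net (j + 1)) * #(net j) := by
              exact_mod_cast (card_filter_le _ _).trans_eq (card_product _ _)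
          _ ≤ Real.exp (D * ((j + 1 : ℕ) + 1)) * Real.exp (D * (j + 1)) := by
              gcongr <;> exact hnet _
          _ = _ := by rw [← Real.exp_add]; push_cast; ring_nf
      rw [Real.exp_neg]
      exact (mul_inv_le_iff₀ (Real.exp_pos _)).2 (by rwa [one_mul])
    have hcount : ∑ _ε : κ → Bool, (1 : ℝ) = M := by simp [hM]
    rw [← Finset.mul_sum, Finset.sum_add_distrib, Finset.sum_comm, hcount]
    simp only [← Finset.mul_sum]
    have htot : ∑ j ∈ range J, ((2 : ℝ) ^ (j + 1))⁻¹ * ∑ ε, ∑ q ∈ links j, g j q ε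
        ≤ M * (2 * E) := by
      calc ∑ j ∈ range J, ((2 : ℝ) ^ (j + 1))⁻¹ * ∑ ε, ∑ q ∈ links j, g j q ε
          ≤ ∑ j ∈ range J, ((2 : ℝ) ^ (j + 1))⁻¹ * (M * (2 * E)) := by
            gcongr with j _
            rw [Finset.sum_comm]; exact hlevel j
        _ = (∑ j ∈ range J, ((2 : ℝ) ^ (j + 1))⁻¹) * (M * (2 * E)) := by rw [Finset.sum_mul]
        _ ≤ _ := mul_le_of_le_one_left (by positivity) (sum_geometric_le_one J)
    rw [Real.exp_add, ← hE]
    have h1 : M + ∑ j ∈ range J, ((2 : ℝ) ^ (j + 1))⁻¹ * ∑ ε, ∑ q ∈ links j, g j q ε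
        ≤ M * (3 * E) := by nlinarith
    calc _ ≤ Real.exp (5 * D) * (M * (3 * E)) := by gcongr
      _ = _ := by ring

end Chaining

/-! ### Symmetrization and the uniform deviation inequality. -/

section Deviation

open Finset
open scoped symmDiff ENNReal

variable {𝒵 : Type*} {κ : Type*} [Fintype κ]

open Classical in
/-- The set of indices `k` at which the point `w k` lies in `s`. -/
noncomputable def trace {I : Type*} [Fintype I] (s : Set 𝒵) (w : I → 𝒵) : Finset I :=
  univ.filter fun k => w k ∈ s

lemma mem_trace {I : Type*} [Fintype I] {s : Set 𝒵} {w : I → 𝒵} {k : I} :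
    k ∈ trace s w ↔ w k ∈ s := by
  simp [trace]

lemma card_trace_eq_sum (s : Set 𝒵) (z : κ → 𝒵) :
    (#(trace s z) : ℝ) = ∑ k, s.indicator (fun _ => (1 : ℝ)) (z k) := by
  classical
  simp [trace, Set.indicator_apply]

lemma card_trace_le (s : Set 𝒵) (z : κ → 𝒵) : (#(trace s z) : ℝ) ≤ Fintype.card κ := by
  exact_mod_cast card_le_univ _

/-- The two samples read off a sample of pairs. -/
def doubled (q : κ → 𝒵 × 𝒵) (p : κ × Bool) : 𝒵 := if p.2 then (q p.1).2 else (q p.1).1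

/-- Exchange the two samples at the positions where `ε` is `true`. -/
def swapAt (ε : κ → Bool) (q : κ → 𝒵 × 𝒵) (k : κ) : 𝒵 × 𝒵 :=
  (if ε k then Prod.swap else id) (q k)

/-- Exchanging the two points of a pair flips the sign of its contribution, so random swaps are
random signs. -/
lemma rademacher_trace [DecidableEq κ] (s : Set 𝒵) (ε : κ → Bool) (q : κ → 𝒵 × 𝒵) :
    rademacher (trace s (doubled q)) ε
      = #(trace s fun k => (swapAt ε q k).1) - #(trace s fun k => (swapAt ε q k).2) := by
  classical
  rw [card_trace_eq_sum, card_trace_eq_sum, ← Finset.sum_sub_distrib, rademacher]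
  refine Finset.sum_congr rfl fun k _ => ?_
  simp only [copyDiff, mem_trace, doubled, swapAt, coin, Set.indicator_apply]
  cases ε k <;> simp

variable [MeasurableSpace 𝒵] (μ : Measure 𝒵) [IsProbabilityMeasure μ]

lemma measurable_card_trace {s : Set 𝒵} (hs : MeasurableSet s) :
    Measurable fun z : κ → 𝒵 => (#(trace s z) : ℝ) := by
  simp only [card_trace_eq_sum]
  exact Finset.measurable_sum _ fun k _ =>
    (measurable_const.indicator hs).comp (measurable_pi_apply k)

lemma integral_card_trace {s : Set 𝒵} (hs : MeasurableSet s) :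
    ∫ z : κ → 𝒵, (#(trace s z) : ℝ) ∂(Measure.pi fun _ => μ) = Fintype.card κ * μ.real s := by
  simp only [card_trace_eq_sum]
  rw [integral_finsetSum]
  · have h : ∀ k : κ, ∫ z : κ → 𝒵, s.indicator (fun _ => (1 : ℝ)) (z k) ∂(Measure.pi fun _ => μ)
        = μ.real s := by
      intro k
      rw [integral_comp_eval (μ := fun _ : κ => μ) (i := k)
        (f := s.indicator fun _ => (1 : ℝ)) (by
          exact (measurable_const.indicator hs).aestronglyMeasurable)]
      exact integral_indicator_one (μ := μ) hs
    simp [h]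
  · intro k _
    exact integrable_comp_eval (μ := fun _ : κ => μ) (i := k)
      ((integrable_const (1 : ℝ)).indicator hs)

lemma integrable_card_trace {s : Set 𝒵} (hs : MeasurableSet s) :
    Integrable (fun z : κ → 𝒵 => (#(trace s z) : ℝ)) (Measure.pi fun _ => μ) :=
  Integrable.of_bound (measurable_card_trace hs).aestronglyMeasurable (Fintype.card κ)
    (Filter.Eventually.of_forall fun z => by
      rw [Real.norm_of_nonneg (by positivity)]; exact card_trace_le s z)

/-- Symmetrization: the deviation of the empirical count is dominated, in exponential moment, by
its difference with an independent copy. -/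
lemma exp_abs_deviation_le {s : Set 𝒵} (hs : MeasurableSet s) {l : ℝ} (hl : 0 ≤ l) (z : κ → 𝒵) :
    ENNReal.ofReal (Real.exp (l * |(#(trace s z) : ℝ) - Fintype.card κ * μ.real s|))
      ≤ ∫⁻ z' : κ → 𝒵, ENNReal.ofReal (Real.exp (l * |(#(trace s z) : ℝ) - #(trace s z')|))
          ∂(Measure.pi fun _ => μ) := by
  set ν : Measure (κ → 𝒵) := Measure.pi fun _ => μ
  have hm : Measurable fun z' : κ → 𝒵 => l * |(#(trace s z) : ℝ) - #(trace s z')| := by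
    have := measurable_card_trace (κ := κ) hs
    exact ((measurable_const.sub this).abs).const_mul l
  have hb : ∀ z' : κ → 𝒵, |(#(trace s z) : ℝ) - #(trace s z')| ≤ Fintype.card κ := by
    intro z'
    have h1 := card_trace_le s z
    have h2 := card_trace_le s z'
    have h3 : (0 : ℝ) ≤ #(trace s z) := by positivity
    have h4 : (0 : ℝ) ≤ #(trace s z') := by positivity
    rw [abs_le]; constructor <;> linarith
  have hint : Integrable (fun z' : κ → 𝒵 => l * |(#(trace s z) : ℝ) - #(trace s z')|) ν :=
    Integrable.of_bound hm.aestronglyMeasurable (l * Fintype.card κ)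
      (Filter.Eventually.of_forall fun z' => by
        rw [Real.norm_of_nonneg (by positivity)]; exact mul_le_mul_of_nonneg_left (hb z') hl)
  have hint2 : Integrable
      (fun z' : κ → 𝒵 => Real.exp (l * |(#(trace s z) : ℝ) - #(trace s z')|)) ν :=
    Integrable.of_bound (Real.measurable_exp.comp hm).aestronglyMeasurable
      (Real.exp (l * Fintype.card κ)) (Filter.Eventually.of_forall fun z' => by
        rw [Real.norm_of_nonneg (by positivity), Real.exp_le_exp]
        exact mul_le_mul_of_nonneg_left (hb z') hl)
  rw [← ofReal_integral_eq_lintegral_ofReal hint2 (Filter.Eventually.of_forall fun _ => by positivity)]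
  refine ENNReal.ofReal_le_ofReal ?_
  -- The mean of the ghost sample is the centring term; Jensen is used first for the absolute value
  -- and then for exp.
  have h1 : |(#(trace s z) : ℝ) - Fintype.card κ * μ.real s|
      ≤ ∫ z', |(#(trace s z) : ℝ) - #(trace s z')| ∂ν := by
    have h2 : ∫ z', ((#(trace s z) : ℝ) - #(trace s z')) ∂ν
        = #(trace s z) - Fintype.card κ * μ.real s := by
      rw [integral_sub (integrable_const _) (integrable_card_trace μ hs), integral_card_trace μ hs]
      simp
    rw [← h2]
    exact abs_integral_le_integral_abs
  calc Real.exp (l * |(#(trace s z) : ℝ) - Fintype.card κ * μ.real s|)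
      ≤ Real.exp (∫ z', l * |(#(trace s z) : ℝ) - #(trace s z')| ∂ν) := by
        rw [integral_const_mul]
        exact Real.exp_le_exp.2 (mul_le_mul_of_nonneg_left h1 hl)
    _ ≤ _ := convexOn_exp.map_integral_le Real.continuous_exp.continuousOn isClosed_univ
        (Filter.Eventually.of_forall fun _ => Set.mem_univ _) hint hint2

lemma measurePreserving_swapAt (ε : κ → Bool) :
    MeasurePreserving (swapAt ε : (κ → 𝒵 × 𝒵) → κ → 𝒵 × 𝒵)
      (Measure.pi fun _ => μ.prod μ) (Measure.pi fun _ => μ.prod μ) := by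
  refine measurePreserving_pi (f := fun k => if ε k then Prod.swap else id) _ _ fun k => ?_
  cases ε k
  · simpa using MeasurePreserving.id _
  · simpa using Measure.measurePreserving_swap

variable {ι : Type*} [Countable ι]

/-- The exponential moment of the largest difference of counts between two independent samples. -/
lemma lintegral_exp_sup_sub_le [DecidableEq κ] {f : ι → Set 𝒵} (hf : ∀ i, MeasurableSet (f i))
    {D : ℝ} (hD : 0 ≤ D)
    (hnets : ∀ w : κ × Bool → 𝒵, ∃ 𝒜, HasNets 𝒜 D ∧ ∀ i, trace (f i) w ∈ 𝒜) {l : ℝ} (hl : 0 ≤ l) :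
    ∫⁻ q : κ → 𝒵 × 𝒵, ⨆ i, ENNReal.ofReal (Real.exp
        (l * |(#(trace (f i) fun k => (q k).1) : ℝ) - #(trace (f i) fun k => (q k).2)|))
      ∂(Measure.pi fun _ => μ.prod μ)
      ≤ ENNReal.ofReal (3 * Real.exp (5 * D + 10 * l ^ 2 * Fintype.card κ)) := by
  set H : (κ → 𝒵 × 𝒵) → ℝ≥0∞ := fun q => ⨆ i, ENNReal.ofReal (Real.exp
    (l * |(#(trace (f i) fun k => (q k).1) : ℝ) - #(trace (f i) fun k => (q k).2)|)) with hH
  set B : ℝ := 3 * Real.exp (5 * D + 10 * l ^ 2 * Fintype.card κ) with hB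
  set ν : Measure (κ → 𝒵 × 𝒵) := Measure.pi fun _ => μ.prod μ with hν
  have hHm : Measurable H := by
    refine Measurable.iSup fun i => ENNReal.measurable_ofReal.comp (Real.measurable_exp.comp ?_)
    have h := measurable_card_trace (κ := κ) (hf i)
    have h1 : Measurable fun q : κ → 𝒵 × 𝒵 => (#(trace (f i) fun k => (q k).1) : ℝ) :=
      h.comp (measurable_pi_lambda _ fun k => measurable_fst.comp (measurable_pi_apply k))
    have h2 : Measurable fun q : κ → 𝒵 × 𝒵 => (#(trace (f i) fun k => (q k).2) : ℝ) :=
      h.comp (measurable_pi_lambda _ fun k => measurable_snd.comp (measurable_pi_apply k))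
    exact ((h1.sub h2).abs).const_mul l
  -- Conditioning on the pairs: with `q` fixed only finitely many traces occur, and the chaining
  -- bound averages over swaps.
  have hpt : ∀ q, ∑ ε : κ → Bool, H (swapAt ε q) ≤ ENNReal.ofReal (2 ^ Fintype.card κ * B) := by
    intro q
    obtain ⟨𝒜, h𝒜, hmem⟩ := hnets (doubled q)
    obtain ⟨S, hS, hsum⟩ := h𝒜.exists_exp_bound hD hl
    have hHS : ∀ ε, H (swapAt ε q) ≤ ENNReal.ofReal (max (S ε) 0) := by
      intro ε
      refine iSup_le fun i => ENNReal.ofReal_le_ofReal ((le_max_left _ _).trans' ?_)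
      rw [← rademacher_trace]
      exact hS ε _ (hmem i)
    -- Nonnegativity of `S` is only known through an index `i`.
    rcases isEmpty_or_nonempty ι with hι | ⟨⟨i⟩⟩
    · simp [hH]
    have hS0 : ∀ ε, max (S ε) 0 = S ε := fun ε =>
      max_eq_left ((Real.exp_pos _).le.trans (hS ε _ (hmem i)))
    simp only [hS0] at hHS
    refine (Finset.sum_le_sum fun ε _ => hHS ε).trans ?_
    rw [← ENNReal.ofReal_sum_of_nonneg fun ε _ => hS0 ε ▸ le_max_right _ _]
    exact ENNReal.ofReal_le_ofReal hsum
  have hswap : ∀ ε : κ → Bool, ∫⁻ q, H (swapAt ε q) ∂ν = ∫⁻ q, H q ∂ν := fun ε =>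
    (measurePreserving_swapAt μ ε).lintegral_comp hHm
  have hsum : (2 ^ Fintype.card κ : ℝ≥0∞) * ∫⁻ q, H q ∂ν
      ≤ 2 ^ Fintype.card κ * ENNReal.ofReal B := by
    calc (2 ^ Fintype.card κ : ℝ≥0∞) * ∫⁻ q, H q ∂ν
        = ∑ ε : κ → Bool, ∫⁻ q, H (swapAt ε q) ∂ν := by simp [hswap]
      _ = ∫⁻ q, ∑ ε : κ → Bool, H (swapAt ε q) ∂ν := by
          rw [lintegral_finsetSum]
          exact fun ε _ => hHm.comp (measurePreserving_swapAt μ ε).measurable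
      _ ≤ ∫⁻ _, ENNReal.ofReal (2 ^ Fintype.card κ * B) ∂ν := lintegral_mono hpt
      _ = _ := by
          rw [lintegral_const, measure_univ, mul_one, ENNReal.ofReal_mul (by positivity)]
          simp [ENNReal.ofReal_pow]
  exact (ENNReal.mul_le_mul_iff_right (by positivity) (by simp)).1 hsum

/-- Uniform deviation inequality for a countable class of sets whose traces have small nets. -/
theorem measure_exists_deviation_le [DecidableEq κ] {f : ι → Set 𝒵} (hf : ∀ i, MeasurableSet (f i))
    {D : ℝ} (hD : 0 ≤ D)
    (hnets : ∀ w : κ × Bool → 𝒵, ∃ 𝒜, HasNets 𝒜 D ∧ ∀ i, trace (f i) w ∈ 𝒜) {u : ℝ} (hu : 0 ≤ u) :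
    (Measure.pi fun _ : κ => μ)
        {z | ∃ i, u * Fintype.card κ ≤ |(#(trace (f i) z) : ℝ) - Fintype.card κ * μ.real (f i)|}
      ≤ ENNReal.ofReal (3 * Real.exp (5 * D - u ^ 2 * Fintype.card κ / 40)) := by
  -- This minimizes 10l² - lu, with value -u² / 40, in the Chernoff bound.
  set l : ℝ := u / 20 with hl
  have hl0 : 0 ≤ l := by positivity
  set ν : Measure (κ → 𝒵) := Measure.pi fun _ : κ => μ with hν
  set F : (κ → 𝒵) → ℝ≥0∞ := fun z => ⨆ i,
    ENNReal.ofReal (Real.exp (l * |(#(trace (f i) z) : ℝ) - Fintype.card κ * μ.real (f i)|)) with hF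
  set G : (κ → 𝒵) × (κ → 𝒵) → ℝ≥0∞ := fun p => ⨆ i, ENNReal.ofReal (Real.exp
    (l * |(#(trace (f i) p.1) : ℝ) - #(trace (f i) p.2)|)) with hG
  have hGm : Measurable G := by
    refine Measurable.iSup fun i => ENNReal.measurable_ofReal.comp (Real.measurable_exp.comp ?_)
    have h := measurable_card_trace (κ := κ) (hf i)
    exact (((h.comp measurable_fst).sub (h.comp measurable_snd)).abs).const_mul l
  have hFm : Measurable F := by
    refine Measurable.iSup fun i => ENNReal.measurable_ofReal.comp (Real.measurable_exp.comp ?_)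
    exact (((measurable_card_trace (κ := κ) (hf i)).sub measurable_const).abs).const_mul l
  have h1 : ∫⁻ z, F z ∂ν ≤ ENNReal.ofReal (3 * Real.exp (5 * D + 10 * l ^ 2 * Fintype.card κ)) := by
    calc ∫⁻ z, F z ∂ν ≤ ∫⁻ z, ∫⁻ z', G (z, z') ∂ν ∂ν := by
          refine lintegral_mono fun z => iSup_le fun i => ?_
          refine (exp_abs_deviation_le μ (hf i) hl0 z).trans (lintegral_mono fun z' => ?_)
          exact le_iSup (fun i => ENNReal.ofReal (Real.exp
            (l * |(#(trace (f i) z) : ℝ) - #(trace (f i) z')|))) i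
      _ = ∫⁻ p, G p ∂(ν.prod ν) := (lintegral_prod _ hGm.aemeasurable).symm
      _ = ∫⁻ q, G (MeasurableEquiv.arrowProdEquivProdArrow 𝒵 𝒵 κ q)
            ∂(Measure.pi fun _ => μ.prod μ) :=
          ((measurePreserving_arrowProdEquivProdArrow 𝒵 𝒵 κ (fun _ => μ) fun _ => μ).lintegral_comp
            hGm).symm
      _ ≤ _ := lintegral_exp_sup_sub_le μ hf hD hnets hl0
  have h2 : ν {z | ∃ i, u * Fintype.card κ ≤ |(#(trace (f i) z) : ℝ) - Fintype.card κ * μ.real (f i)|}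
      ≤ ν {z | ENNReal.ofReal (Real.exp (l * (u * Fintype.card κ))) ≤ F z} := by
    refine measure_mono fun z ⟨i, hi⟩ => ?_
    refine le_trans (ENNReal.ofReal_le_ofReal ?_) (le_iSup (fun i => ENNReal.ofReal
      (Real.exp (l * |(#(trace (f i) z) : ℝ) - Fintype.card κ * μ.real (f i)|))) i)
    exact Real.exp_le_exp.2 (mul_le_mul_of_nonneg_left hi hl0)
  have hpos : 0 < Real.exp (l * (u * Fintype.card κ)) := Real.exp_pos _
  refine h2.trans ((meas_ge_le_lintegral_div hFm.aemeasurable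
    (by simpa using Real.exp_pos _) ENNReal.ofReal_ne_top).trans ?_)
  refine (ENNReal.div_le_div_right h1 _).trans ?_
  rw [← ENNReal.ofReal_div_of_pos hpos]
  refine ENNReal.ofReal_le_ofReal (le_of_eq ?_)
  rw [mul_div_assoc, ← Real.exp_sub, hl]
  congr 2
  ring

end Deviation

/-! ### Traces of sparse half-spaces and reduction to rational parameters. -/

section HalfSpaces

open Finset Filter Topology
open scoped symmDiff ENNReal

/-- The open half-space `{(a, b) : ⟨x, a⟩ + b > c}`. -/
def halfSpace {n : ℕ} (x : EuclideanSpace ℝ (Fin n)) (c : ℝ) : Set (EuclideanSpace ℝ (Fin n) × ℝ) :=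
  {p | c < inner ℝ x p.1 + p.2}

variable {n : ℕ}

lemma measurableSet_halfSpace (x : EuclideanSpace ℝ (Fin n)) (c : ℝ) :
    MeasurableSet (halfSpace x c) :=
  measurableSet_lt measurable_const (by fun_prop)

lemma real_inner_eq_sum (x a : EuclideanSpace ℝ (Fin n)) : inner ℝ x a = ∑ j, x j * a j := by
  simp [PiLp.inner_apply, mul_comm]

open Classical in
/-- The traces, on the points `w`, of the half-spaces whose normal vector is supported in `S`. -/
noncomputable def halfSpaceTraces {I : Type*} [Fintype I] (S : Finset (Fin n))
    (w : I → EuclideanSpace ℝ (Fin n) × ℝ) : Finset (Finset I) :=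
  univ.filter fun A => ∃ (x : EuclideanSpace ℝ (Fin n)) (c : ℝ),
    (∀ j ∉ S, x j = 0) ∧ trace (halfSpace x c) w = A

variable {I : Type*} [Fintype I] [DecidableEq I]

omit [DecidableEq I] in
lemma trace_mem_halfSpaceTraces {S : Finset (Fin n)} (w : I → EuclideanSpace ℝ (Fin n) × ℝ)
    {x : EuclideanSpace ℝ (Fin n)} (c : ℝ) (hx : ∀ j ∉ S, x j = 0) :
    trace (halfSpace x c) w ∈ halfSpaceTraces S w := by
  simp only [halfSpaceTraces, mem_filter, mem_univ, true_and]
  exact ⟨x, c, hx, rfl⟩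

/-- An affine dependence with a positive coefficient prevents a set from being shattered. -/
lemma not_shatters_of_relation {S : Finset (Fin n)} (w : I → EuclideanSpace ℝ (Fin n) × ℝ)
    (T : Finset I) (g : I → ℝ) (h1 : ∀ j ∈ S, ∑ i ∈ T, g i * (w i).1 j = 0)
    (h2 : ∑ i ∈ T, g i * (w i).2 = 0) (h3 : ∑ i ∈ T, g i = 0) (hpos : ∃ i ∈ T, 0 < g i) :
    ¬ (halfSpaceTraces S w).Shatters T := by
  classical
  intro hsh
  obtain ⟨A, hA, hTA⟩ := hsh (t := T.filter fun i => 0 < g i) (filter_subset _ _)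
  simp only [halfSpaceTraces, mem_filter, mem_univ, true_and] at hA
  obtain ⟨x, c, hx, rfl⟩ := hA
  have hiff : ∀ i ∈ T, (0 < g i ↔ c < inner ℝ x (w i).1 + (w i).2) := by
    intro i hi
    have := congrArg (fun s => i ∈ s) hTA
    simp only [mem_inter, mem_trace, mem_filter, hi, true_and, eq_iff_iff] at this
    exact this.symm
  -- The dependence kills every affine functional. If a half-space cut out exactly the indices with
  -- positive coefficient, all terms would be nonnegative and one positive.
  have hsum : ∑ i ∈ T, g i * (inner ℝ x (w i).1 + (w i).2 - c) = 0 := by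
    have h4 : ∑ i ∈ T, g i * inner ℝ x (w i).1 = 0 := by
      simp only [real_inner_eq_sum, Finset.mul_sum]
      rw [Finset.sum_comm]
      refine Finset.sum_eq_zero fun j _ => ?_
      by_cases hj : j ∈ S
      · rw [← mul_zero (x j), ← h1 j hj, Finset.mul_sum]
        exact Finset.sum_congr rfl fun i _ => by ring
      · simp [hx j hj]
    simp only [mul_sub, mul_add, Finset.sum_sub_distrib, Finset.sum_add_distrib, h4, h2,
      ← Finset.sum_mul, h3]
    simp
  obtain ⟨i, hi, hgi⟩ := hpos
  have hterm : 0 < g i * (inner ℝ x (w i).1 + (w i).2 - c) :=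
    mul_pos hgi (sub_pos.2 ((hiff i hi).1 hgi))
  have : 0 < ∑ i ∈ T, g i * (inner ℝ x (w i).1 + (w i).2 - c) := by
    refine Finset.sum_pos' (fun k hk => ?_) ⟨i, hi, hterm⟩
    by_cases hk' : 0 < g k
    · exact (mul_pos hk' (sub_pos.2 ((hiff k hk).1 hk'))).le
    · refine mul_nonneg_of_nonpos_of_nonpos (not_lt.1 hk') ?_
      have := mt (hiff k hk).2 hk'
      linarith
  linarith

/-- Lift each point to its coordinates in `S`, its noise and the constant 1, in dimension `#S + 2`.
Any larger set is dependent (Radon's argument), and changing the sign of the relation if necessary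
gives a positive coefficient. -/
lemma vcDim_halfSpaceTraces_le (S : Finset (Fin n)) (w : I → EuclideanSpace ℝ (Fin n) × ℝ) :
    (halfSpaceTraces S w).vcDim ≤ #S + 2 := by
  refine Finset.sup_le fun T hT => ?_
  rw [mem_shatterer] at hT
  by_contra! hcard
  set v : T → (S → ℝ) × ℝ × ℝ := fun i => (fun j => (w i).1 j, (w i).2, 1) with hv
  have hdep : ¬ LinearIndependent ℝ v := by
    intro h
    have h1 := h.fintype_card_le_finrank
    simp only [Module.finrank_prod, Module.finrank_fintype_fun_eq_card, Module.finrank_self,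
      Fintype.card_coe] at h1
    omega
  obtain ⟨g, hg, i₀, hi₀⟩ := Fintype.not_linearIndependent_iff.1 hdep
  set G : I → ℝ := fun i => if h : i ∈ T then g ⟨i, h⟩ else 0 with hG
  have hGg : ∀ φ : I → ℝ, ∑ i ∈ T, G i * φ i = ∑ i : T, g i * φ i := by
    intro φ
    rw [← Finset.sum_coe_sort T]
    exact Finset.sum_congr rfl fun i _ => by simp [hG]
  have h1 : ∀ j ∈ S, ∑ i ∈ T, G i * (w i).1 j = 0 := by
    intro j hj
    rw [hGg fun i => (w i).1 j]
    have := congrFun (congrArg Prod.fst hg) ⟨j, hj⟩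
    simpa [hv, Prod.fst_sum] using this
  have h2 : ∑ i ∈ T, G i * (w i).2 = 0 := by
    rw [hGg fun i => (w i).2]
    have := congrArg (fun p => p.2.1) hg
    simpa [hv, Prod.fst_sum, Prod.snd_sum] using this
  have h3 : ∑ i ∈ T, G i = 0 := by
    have h4 := hGg fun _ => 1
    simp only [mul_one] at h4
    rw [h4]
    have := congrArg (fun p => p.2.2) hg
    simpa [hv, Prod.snd_sum] using this
  have hGi₀ : G i₀ = g i₀ := by simp [hG]
  rcases lt_or_gt_of_ne hi₀ with hneg | hpos
  · refine not_shatters_of_relation w T (fun i => -G i) (fun j hj => ?_) ?_ ?_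
      ⟨i₀, i₀.2, by rw [hGi₀]; linarith⟩ hT
    · simp [h1 j hj]
    · simp [h2]
    · simp [h3]
  · exact not_shatters_of_relation w T G h1 h2 h3 ⟨i₀, i₀.2, by rwa [hGi₀]⟩ hT

/-- Combine n.choose s ≤ n^s / s! with s^s / s! ≤ e^s. -/
lemma choose_le_exp {s : ℕ} (hs : 1 ≤ s) (hsn : s ≤ n) :
    (n.choose s : ℝ) ≤ Real.exp (s * Real.log (Real.exp 1 * n / s)) := by
  have hs0 : (0 : ℝ) < s := by exact_mod_cast hs
  have hn0 : (0 : ℝ) < n := by exact_mod_cast hs.trans hsn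
  have h1 := Nat.choose_le_pow_div (α := ℝ) s n
  have h2 := Real.pow_div_factorial_le_exp (s : ℝ) hs0.le s
  rw [Real.exp_nat_mul, Real.exp_log (by positivity), div_pow, mul_pow, ← Real.exp_nat_mul, mul_one]
  refine h1.trans ?_
  rw [div_le_iff₀ (by positivity)] at h2
  rw [div_le_div_iff₀ (by positivity) (by positivity)]
  nlinarith [pow_pos hn0 s]

/-- `s log (e n / s)`, the complexity of the set of `s`-sparse vectors. -/
noncomputable def sparseEntropy (n s : ℕ) : ℝ := s * Real.log (Real.exp 1 * n / s)

lemma le_sparseEntropy {s : ℕ} (hs : 1 ≤ s) (hsn : s ≤ n) : (s : ℝ) ≤ sparseEntropy n s := by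
  have hs0 : (0 : ℝ) < s := by exact_mod_cast hs
  have hsn' : (s : ℝ) ≤ n := by exact_mod_cast hsn
  have hn0 : (0 : ℝ) < n := hs0.trans_le hsn'
  have h : 1 ≤ Real.log (Real.exp 1 * n / s) := by
    rw [Real.le_log_iff_exp_le (by positivity), le_div_iff₀ hs0]
    gcongr
  exact le_mul_of_one_le_right hs0.le h

/-- The union over supports costs L = `sparseEntropy n s`. Since s + 2 ≤ 3s ≤ 3L, the entropy of
single half-spaces is at most 16L, and symmetric differences multiply it by 4. -/
lemma exists_hasNets_sparse {s : ℕ} (hs : 1 ≤ s) (hsn : s ≤ n)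
    (w : I → EuclideanSpace ℝ (Fin n) × ℝ) :
    ∃ 𝒜 : Finset (Finset I), HasNets 𝒜 (64 * sparseEntropy n s) ∧
      ∀ S S' : Finset (Fin n), #S = s → #S' = s → ∀ (x y : EuclideanSpace ℝ (Fin n)) (c c' : ℝ),
        (∀ j ∉ S, x j = 0) → (∀ j ∉ S', y j = 0) →
        trace (halfSpace x c ∆ halfSpace y c') w ∈ 𝒜 := by
  have hL := le_sparseEntropy hs hsn
  have hs1 : (1 : ℝ) ≤ s := by exact_mod_cast hs
  set ℬ : Finset (Finset I) :=
    (powersetCard s (univ : Finset (Fin n))).biUnion fun S => halfSpaceTraces S w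
  have hℬ : HasNets ℬ (5 * (s + 2 : ℕ) + sparseEntropy n s) := by
    refine HasNets.biUnion _ _ (by linarith) ?_ fun S hS => ?_
    · rw [card_powersetCard, card_univ, Fintype.card_fin]
      exact choose_le_exp hs hsn
    · refine HasNets.of_vcDim_le (by omega) ?_
      rw [← (mem_powersetCard.1 hS).2]
      exact vcDim_halfSpaceTraces_le S w
  refine ⟨image₂ (· ∆ ·) ℬ ℬ, (hℬ.symmDiff (by push_cast; linarith)).mono subset_rfl ?_, ?_⟩
  · push_cast
    linarith
  · intro S S' hS hS' x y c c' hx hy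
    have h : trace (halfSpace x c ∆ halfSpace y c') w
        = trace (halfSpace x c) w ∆ trace (halfSpace y c') w := by
      ext i
      simp only [mem_trace, mem_symmDiff, Set.mem_symmDiff]
    rw [h]
    exact mem_image₂_of_mem
      (mem_biUnion.2 ⟨S, mem_powersetCard_univ.2 hS, trace_mem_halfSpaceTraces w c hx⟩)
      (mem_biUnion.2 ⟨S', mem_powersetCard_univ.2 hS', trace_mem_halfSpaceTraces w c' hy⟩)

/-- Parameters of the half-spaces with rational coefficients and `s`-sparse normal vector. -/
abbrev RatParam (n s : ℕ) : Type := {S : Finset (Fin n) // #S = s} × (Fin n → ℚ) × ℚ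

/-- The normal vector of a rational half-space. -/
noncomputable def RatParam.vec {s : ℕ} (q : RatParam n s) : EuclideanSpace ℝ (Fin n) :=
  WithLp.toLp 2 fun j => if j ∈ q.1.1 then (q.2.1 j : ℝ) else 0

/-- The half-space with rational parameters `q`. -/
noncomputable def RatParam.set {s : ℕ} (q : RatParam n s) : Set (EuclideanSpace ℝ (Fin n) × ℝ) :=
  halfSpace q.vec q.2.2

/-- A half-space through the origin with sparse normal vector is a pointwise limit of rational
half-spaces. -/
lemma exists_ratParam_tendsto {s : ℕ} (hsn : s ≤ n) {x : EuclideanSpace ℝ (Fin n)}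
    (hx : {j : Fin n | x j ≠ 0}.ncard ≤ s) :
    ∃ q : ℕ → RatParam n s, ∀ p, ∀ᶠ k in atTop, p ∈ (q k).set ↔ p ∈ halfSpace x 0 := by
  classical
  obtain ⟨S, hS, -, hcard⟩ := exists_subsuperset_card_eq
    (subset_univ (univ.filter fun j => x j ≠ 0)) (n := s)
    (by rwa [Set.ncard_eq_toFinset_card', Set.toFinset_ofPred] at hx) (by simpa using hsn)
  have hxS : ∀ j ∉ S, x j = 0 := by
    intro j hj
    by_contra h
    exact hj (hS (by simp [h]))
  choose r hr using fun (k : ℕ) (j : Fin n) =>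
    exists_rat_near (x j) (show (0 : ℝ) < ((k + 1 : ℝ) ^ 2)⁻¹ by positivity)
  -- The threshold (k + 1)⁻¹ dominates the coefficient error, of order (k + 1)⁻². Points on the
  -- boundary hyperplane are thus eventually excluded, as the open half-space and `sgn 0 = -1`
  -- require.
  refine ⟨fun k => (⟨S, hcard⟩, r k, ((k : ℚ) + 1)⁻¹), fun p => ?_⟩
  set M : ℝ := ∑ j, |p.1 j| with hM
  have hM0 : 0 ≤ M := Finset.sum_nonneg fun j _ => abs_nonneg _
  set h : ℝ := inner ℝ x p.1 + p.2 with hh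
  set qv : ℕ → EuclideanSpace ℝ (Fin n) := fun k =>
    RatParam.vec (s := s) (⟨S, hcard⟩, r k, ((k : ℚ) + 1)⁻¹) with hqv
  have herr : ∀ k : ℕ, |inner ℝ (qv k) p.1 + p.2 - h| ≤ M * ((k + 1 : ℝ) ^ 2)⁻¹ := by
    intro k
    have h1 : inner ℝ (qv k) p.1 + p.2 - h = ∑ j, (qv k j - x j) * p.1 j := by
      rw [hh, real_inner_eq_sum, real_inner_eq_sum]
      simp only [sub_mul, Finset.sum_sub_distrib]
      ring
    rw [h1, hM, Finset.sum_mul]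
    refine (Finset.abs_sum_le_sum_abs _ _).trans (Finset.sum_le_sum fun j _ => ?_)
    rw [abs_mul, mul_comm]
    refine mul_le_mul_of_nonneg_left ?_ (abs_nonneg _)
    by_cases hj : j ∈ S
    · simp only [hqv, RatParam.vec, hj, if_true]
      rw [abs_sub_comm]
      exact (hr k j).le
    · simp only [hqv, RatParam.vec, hj, if_false, hxS j hj, sub_self, abs_zero]
      positivity
  have hmem : ∀ k : ℕ, p ∈ RatParam.set (s := s) (⟨S, hcard⟩, r k, ((k : ℚ) + 1)⁻¹) ↔
      ((k : ℝ) + 1)⁻¹ < inner ℝ (qv k) p.1 + p.2 := by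
    intro k
    simp [RatParam.set, halfSpace, hqv]
  have hmem' : p ∈ halfSpace x 0 ↔ 0 < h := Iff.rfl
  simp only [hmem, hmem']
  by_cases hpos : 0 < h
  · have hev : ∀ᶠ k : ℕ in atTop, (M + 1) / h < k := by
      exact tendsto_natCast_atTop_atTop.eventually_gt_atTop _
    filter_upwards [hev] with k hk
    simp only [hpos, iff_true]
    have h1 := (abs_le.1 (herr k)).1
    have hk1 : (0 : ℝ) < (k : ℝ) + 1 := by positivity
    have h2 : ((k + 1 : ℝ) ^ 2)⁻¹ ≤ (k + 1 : ℝ)⁻¹ := by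
      refine inv_anti₀ hk1 (le_self_pow₀ ?_ two_ne_zero)
      linarith [Nat.cast_nonneg (α := ℝ) k]
    have h3 : (M + 1) * (k + 1 : ℝ)⁻¹ < h := by
      rw [← div_eq_mul_inv, div_lt_iff₀ hk1]
      rw [div_lt_iff₀ hpos] at hk
      nlinarith
    have h4 := mul_le_mul_of_nonneg_left h2 hM0
    linarith
  · have hev : ∀ᶠ k : ℕ in atTop, M < k := by
      exact tendsto_natCast_atTop_atTop.eventually_gt_atTop _
    filter_upwards [hev] with k hk
    simp only [hpos, iff_false, not_lt]
    have h1 := (abs_le.1 (herr k)).2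
    have hk1 : (0 : ℝ) < (k : ℝ) + 1 := by positivity
    have h2 : M * ((k + 1 : ℝ) ^ 2)⁻¹ ≤ (k + 1 : ℝ)⁻¹ := by
      rw [← div_eq_mul_inv, div_le_iff₀ (by positivity), sq, inv_mul_cancel_left₀ hk1.ne']
      linarith
    linarith

/-- Uniform deviation inequality for the disagreement regions of pairs of sparse half-spaces. -/
theorem measure_exists_sparse_deviation_le (μ : Measure (EuclideanSpace ℝ (Fin n) × ℝ))
    [IsProbabilityMeasure μ] (m : ℕ) {s : ℕ} (hs : 1 ≤ s) (hsn : s ≤ n) {u : ℝ} (hu : 0 ≤ u) :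
    (Measure.pi fun _ : Fin m => μ) {z | ∃ x ∈ sparseSphere n s, ∃ y ∈ sparseSphere n s,
        u * m < |(#(trace (halfSpace x 0 ∆ halfSpace y 0) z) : ℝ)
          - m * μ.real (halfSpace x 0 ∆ halfSpace y 0)|}
      ≤ ENNReal.ofReal (3 * Real.exp (320 * sparseEntropy n s - u ^ 2 * m / 40)) := by
  have hL := le_sparseEntropy hs hsn
  have hL0 : 0 ≤ sparseEntropy n s := (Nat.cast_nonneg s).trans hL
  set f : RatParam n s × RatParam n s → Set (EuclideanSpace ℝ (Fin n) × ℝ) :=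
    fun q => q.1.set ∆ q.2.set with hf
  have hfm : ∀ q, MeasurableSet (f q) := fun q =>
    (measurableSet_halfSpace _ _).symmDiff (measurableSet_halfSpace _ _)
  have hvec : ∀ q : RatParam n s, ∀ j ∉ q.1.1, q.vec j = 0 := fun q j hj => by
    simp [RatParam.vec, hj]
  have key := measure_exists_deviation_le (κ := Fin m) μ hfm (D := 64 * sparseEntropy n s)
    (by positivity) (fun w => by
      obtain ⟨𝒜, h1, h2⟩ := exists_hasNets_sparse hs hsn w
      exact ⟨𝒜, h1, fun q => h2 q.1.1.1 q.2.1.1 q.1.1.2 q.2.1.2 _ _ _ _ (hvec _) (hvec _)⟩) hu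
  rw [Fintype.card_fin, ← mul_assoc] at key
  norm_num only at key
  refine (measure_mono ?_).trans key
  rintro z ⟨x, hx, y, hy, hxy⟩
  obtain ⟨p, hp⟩ := exists_ratParam_tendsto hsn hx.2
  obtain ⟨q, hq⟩ := exists_ratParam_tendsto hsn hy.2
  have hlim : ∀ a, ∀ᶠ k in atTop,
      a ∈ f (p k, q k) ↔ a ∈ halfSpace x 0 ∆ halfSpace y 0 := by
    intro a
    filter_upwards [hp a, hq a] with k h1 h2
    simp only [hf, Set.mem_symmDiff, h1, h2]
  have hmeas : Tendsto (fun k => μ.real (f (p k, q k))) atTop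
      (𝓝 (μ.real (halfSpace x 0 ∆ halfSpace y 0))) :=
    (ENNReal.tendsto_toReal (measure_ne_top _ _)).comp
      (tendsto_measure_of_tendsto_indicator_of_isFiniteMeasure atTop μ (fun k => hfm _) hlim)
  have htrace : ∀ᶠ k in atTop,
      trace (f (p k, q k)) z = trace (halfSpace x 0 ∆ halfSpace y 0) z := by
    filter_upwards [eventually_all.2 fun i => hlim (z i)] with k hk
    ext i
    simp only [mem_trace, hk i]
  -- The strict inequality in the event survives at some finite k, where the trace already agrees
  -- with its limit.
  have hev := ((tendsto_const_nhds (x := (#(trace (halfSpace x 0 ∆ halfSpace y 0) z) : ℝ))).sub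
    (hmeas.const_mul (m : ℝ))).abs.eventually (eventually_gt_nhds hxy)
  obtain ⟨k, hk1, hk2⟩ := (htrace.and hev).exists
  refine ⟨(p k, q k), ?_⟩
  rw [hk1]
  exact hk2.le

end HalfSpaces

/-! ### Gaussian measure of a planar wedge. -/

section Orthant

open Real Set
open scoped ENNReal

/-- The standard Gaussian measure of a planar set that is a cone over a set `A` of angles is
proportional to the length of `A`. -/
lemma gaussian_prod_cone {S : Set (ℝ × ℝ)} {A : Set ℝ} (hS : MeasurableSet S) (hA : MeasurableSet A)
    (h : ∀ r φ : ℝ, 0 < r → φ ∈ Ioo (-π) π → ((r * cos φ, r * sin φ) ∈ S ↔ φ ∈ A)) :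
    ((gaussianReal 0 1).prod (gaussianReal 0 1)) S
      = (∫⁻ r in Ioi (0 : ℝ), ENNReal.ofReal (r * ((2 * π)⁻¹ * exp (-r ^ 2 / 2))))
        * volume (A ∩ Ioo (-π) π) := by
  have hdens : (gaussianReal 0 1).prod (gaussianReal 0 1) = (volume : Measure (ℝ × ℝ)).withDensity
      fun p => ENNReal.ofReal ((2 * π)⁻¹ * exp (-(p.1 ^ 2 + p.2 ^ 2) / 2)) := by
    rw [gaussianReal_of_var_ne_zero _ one_ne_zero,
      prod_withDensity (measurable_gaussianPDF _ _) (measurable_gaussianPDF _ _)]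
    congr 1
    funext p
    rw [gaussianPDF, gaussianPDF, ← ENNReal.ofReal_mul (gaussianPDFReal_nonneg _ _ _)]
    congr 1
    simp only [gaussianPDFReal, NNReal.coe_one, mul_one, sub_zero]
    rw [mul_mul_mul_comm, ← mul_inv, mul_self_sqrt (by positivity), ← exp_add]
    congr 2
    ring
  rw [hdens, withDensity_apply _ hS, ← lintegral_indicator hS, ← lintegral_comp_polarCoord_symm]
  have htarget : polarCoord.target = Ioi (0 : ℝ) ×ˢ Ioo (-π) π := rfl
  have hpt : ∀ p ∈ polarCoord.target, ENNReal.ofReal p.1 •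
      S.indicator (fun p => ENNReal.ofReal ((2 * π)⁻¹ * exp (-(p.1 ^ 2 + p.2 ^ 2) / 2)))
        (polarCoord.symm p)
      = ENNReal.ofReal (p.1 * ((2 * π)⁻¹ * exp (-p.1 ^ 2 / 2))) * A.indicator 1 p.2 := by
    rintro ⟨r, φ⟩ ⟨hr, hφ⟩
    have hr' : 0 < r := hr
    simp only [polarCoord_symm_apply, smul_eq_mul]
    by_cases hφA : φ ∈ A
    · rw [indicator_of_mem hφA, indicator_of_mem ((h r φ hr' hφ).2 hφA), Pi.one_apply, mul_one,
        ENNReal.ofReal_mul hr'.le, mul_pow, mul_pow, ← mul_add, cos_sq_add_sin_sq, mul_one]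
    · rw [indicator_of_notMem hφA, indicator_of_notMem fun hS => hφA ((h r φ hr' hφ).1 hS),
        mul_zero, mul_zero]
  rw [setLIntegral_congr_fun (by rw [htarget]; exact measurableSet_Ioi.prod measurableSet_Ioo) hpt,
    htarget, Measure.volume_eq_prod, ← Measure.prod_restrict,
    lintegral_prod_mul (f := fun r => ENNReal.ofReal (r * ((2 * π)⁻¹ * exp (-r ^ 2 / 2))))
      (g := A.indicator 1) (by fun_prop) (measurable_one.indicator hA).aemeasurable,
    lintegral_indicator_one hA, Measure.restrict_apply hA]

/-- The standard Gaussian measure of a planar cone is its proportion of angles. -/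
lemma gaussian_prod_cone_eq {S : Set (ℝ × ℝ)} {A : Set ℝ} (hS : MeasurableSet S)
    (hA : MeasurableSet A)
    (h : ∀ r φ : ℝ, 0 < r → φ ∈ Ioo (-π) π → ((r * cos φ, r * sin φ) ∈ S ↔ φ ∈ A)) :
    ((gaussianReal 0 1).prod (gaussianReal 0 1)).real S
      = volume.real (A ∩ Ioo (-π) π) / (2 * π) := by
  have h1 := congrArg ENNReal.toReal (gaussian_prod_cone hS hA h)
  -- The whole plane is a cone too, and total mass 1 fixes the radial integral without computing it.
  have h2 := congrArg ENNReal.toReal (gaussian_prod_cone (S := univ) (A := univ)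
    MeasurableSet.univ MeasurableSet.univ fun _ _ _ _ => by simp)
  rw [ENNReal.toReal_mul] at h1 h2
  rw [measure_univ, univ_inter, Real.volume_Ioo, ENNReal.toReal_ofReal (by linarith [pi_pos])] at h2
  rw [measureReal_def, h1, measureReal_def, eq_div_iff (by positivity)]
  rw [ENNReal.toReal_one] at h2
  rw [mul_right_comm, show ∀ K : ℝ, K * (2 * π) = K * (π - -π) by intro K; ring, ← h2, one_mul]

lemma mul_nonpos_iff_right_of_pos {a b : ℝ} (ha : 0 < a) : a * b ≤ 0 ↔ b ≤ 0 := by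
  rw [← not_lt, ← not_lt, mul_pos_iff_of_pos_left ha]

/-- In polar coordinates the conditions are cos φ > 0 and cos(φ - θ) ≤ 0, an arc from -π/2 to θ -
π/2. Sandwiching between the open and the closed interval avoids treating the endpoints. -/
lemma gaussian_prod_wedge {θ : ℝ} (h0 : 0 ≤ θ) (hπ : θ ≤ π) :
    ((gaussianReal 0 1).prod (gaussianReal 0 1)).real
      {g | 0 < g.1 ∧ cos θ * g.1 + sin θ * g.2 ≤ 0} = θ / (2 * π) := by
  have hpi := pi_pos
  set A : Set ℝ := {φ | 0 < cos φ ∧ cos (φ - θ) ≤ 0} with hA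
  have hAm : MeasurableSet A :=
    (measurableSet_lt measurable_const continuous_cos.measurable).inter
      (measurableSet_le (continuous_cos.comp (continuous_id.sub continuous_const)).measurable
        measurable_const)
  have hSm : MeasurableSet {g : ℝ × ℝ | 0 < g.1 ∧ cos θ * g.1 + sin θ * g.2 ≤ 0} :=
    (measurableSet_lt measurable_const measurable_fst).inter
      (measurableSet_le ((measurable_fst.const_mul _).add (measurable_snd.const_mul _))
        measurable_const)
  rw [gaussian_prod_cone_eq hSm hAm]
  · congr 1
    have hsub : A ∩ Ioo (-π) π ⊆ Icc (-(π / 2)) (θ - π / 2) := by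
      rintro φ ⟨⟨h1, h2⟩, h3, h4⟩
      have h5 : -(π / 2) < φ := by
        by_contra hcon
        have := cos_nonpos_of_pi_div_two_le_of_le (x := -φ) (by linarith) (by linarith)
        rw [cos_neg] at this
        linarith
      have h6 : φ < π / 2 := by
        by_contra hcon
        have := cos_nonpos_of_pi_div_two_le_of_le (x := φ) (by linarith) (by linarith)
        linarith
      refine ⟨h5.le, ?_⟩
      by_contra hcon
      have := cos_pos_of_mem_Ioo (x := φ - θ) ⟨by linarith, by linarith⟩
      linarith
    have hsup : Ioo (-(π / 2)) (θ - π / 2) ⊆ A ∩ Ioo (-π) π := by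
      rintro φ ⟨h1, h2⟩
      refine ⟨⟨cos_pos_of_mem_Ioo ⟨h1, by linarith⟩, ?_⟩, by linarith, by linarith⟩
      rw [← cos_neg]
      exact cos_nonpos_of_pi_div_two_le_of_le (by linarith) (by linarith)
    have hlen : θ - π / 2 - -(π / 2) = θ := by ring
    refine le_antisymm ?_ ?_
    · refine (measureReal_mono hsub (by simp)).trans_eq ?_
      rw [measureReal_def, Real.volume_Icc, hlen, ENNReal.toReal_ofReal h0]
    · refine le_trans (le_of_eq ?_) (measureReal_mono hsup
        ((measure_mono inter_subset_right).trans_lt (by simp)).ne)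
      rw [measureReal_def, Real.volume_Ioo, hlen, ENNReal.toReal_ofReal h0]
  · intro r φ hr _
    simp only [mem_ofPred_eq, hA, mul_pos_iff_of_pos_left hr]
    rw [show cos θ * (r * cos φ) + sin θ * (r * sin φ) = r * cos (φ - θ) by rw [cos_sub]; ring,
      mul_nonpos_iff_right_of_pos hr]

end Orthant

/-! ### Joint law of two noisy measurements. -/

section Bivariate

open Real
open scoped symmDiff NNReal

variable {E : Type*} [NormedAddCommGroup E] [InnerProductSpace ℝ E] [MeasurableSpace E]
  [BorelSpace E]

lemma charFunDual_gaussianReal_of_apply {v : ℝ≥0} {L : StrongDual ℝ ℝ} {c : ℝ}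
    (hL : ∀ t, L t = c * t) :
    charFunDual (gaussianReal 0 v) L = Complex.exp (-(v * c ^ 2 : ℝ) / 2) := by
  have h : L = InnerProductSpace.toDualMap ℝ ℝ c := by
    ext
    simp [hL]
  rw [h, ← charFun_eq_charFunDual_toDualMap, charFun_gaussianReal]
  push_cast
  congr 1
  ring

lemma charFunDual_stdGaussian_of_apply [FiniteDimensional ℝ E] {L : StrongDual ℝ E} {a : E}
    (hL : ∀ t, L t = inner ℝ a t) :
    charFunDual (stdGaussian E) L = Complex.exp (-(‖a‖ ^ 2 : ℝ) / 2) := by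
  have h : L = InnerProductSpace.toDualMap ℝ E a := by
    ext
    simp [hL]
  rw [h, ← charFun_eq_charFunDual_toDualMap, charFun_stdGaussian]
  push_cast
  rfl

variable [FiniteDimensional ℝ E]

/-- The law of a row of the matrix together with its noise. -/
noncomputable def rowLaw (E : Type*) [NormedAddCommGroup E] [InnerProductSpace ℝ E]
    [MeasurableSpace E] [FiniteDimensional ℝ E] (σ : ℝ) : Measure (E × ℝ) :=
  (stdGaussian E).prod (gaussianReal 0 (σ ^ 2).toNNReal)

instance isProbabilityMeasure_rowLaw (σ : ℝ) : IsProbabilityMeasure (rowLaw E σ) := by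
  unfold rowLaw; infer_instance

/-- Two noisy measurements of unit vectors are jointly distributed as correlated Gaussians. -/
lemma map_rowLaw_eq {x y : E} (hx : ‖x‖ = 1) (hy : ‖y‖ = 1) (σ : ℝ) {θ : ℝ}
    (hθ : (1 + σ ^ 2) * cos θ = inner ℝ x y + σ ^ 2) :
    (rowLaw E σ).map (fun p => (inner ℝ x p.1 + p.2, inner ℝ y p.1 + p.2))
      = ((gaussianReal 0 1).prod (gaussianReal 0 1)).map fun g =>
        (√(1 + σ ^ 2) * g.1, √(1 + σ ^ 2) * (cos θ * g.1 + sin θ * g.2)) := by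
  set τ : ℝ := √(1 + σ ^ 2) with hτ
  have hτ2 : τ ^ 2 = 1 + σ ^ 2 := sq_sqrt (by positivity)
  set T : (E × ℝ) →L[ℝ] ℝ × ℝ :=
    ((innerSL ℝ x).comp (ContinuousLinearMap.fst ℝ E ℝ) + ContinuousLinearMap.snd ℝ E ℝ).prod
      ((innerSL ℝ y).comp (ContinuousLinearMap.fst ℝ E ℝ) + ContinuousLinearMap.snd ℝ E ℝ) with hT
  set R : (ℝ × ℝ) →L[ℝ] ℝ × ℝ := (τ • ContinuousLinearMap.fst ℝ ℝ ℝ).prod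
    (τ • (cos θ • ContinuousLinearMap.fst ℝ ℝ ℝ + sin θ • ContinuousLinearMap.snd ℝ ℝ ℝ)) with hR
  have hTf : (fun p : E × ℝ => (inner ℝ x p.1 + p.2, inner ℝ y p.1 + p.2)) = T := by
    funext p; simp [hT]
  have hRf : (fun g : ℝ × ℝ => (τ * g.1, τ * (cos θ * g.1 + sin θ * g.2))) = R := by
    funext g; simp [hR, mul_add]
  rw [hTf, hRf]
  have : IsProbabilityMeasure ((rowLaw E σ).map T) :=
    Measure.isProbabilityMeasure_map (by fun_prop)
  have : IsProbabilityMeasure (((gaussianReal 0 1).prod (gaussianReal 0 1)).map R) :=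
    Measure.isProbabilityMeasure_map (by fun_prop)
  refine Measure.ext_of_charFunDual (funext fun L => ?_)
  have hL : ∀ p : ℝ × ℝ, L p = L (1, 0) * p.1 + L (0, 1) * p.2 := by
    intro p
    have : p = p.1 • ((1 : ℝ), (0 : ℝ)) + p.2 • ((0 : ℝ), (1 : ℝ)) := by
      ext <;> simp
    conv_lhs => rw [this]
    rw [map_add, map_smul, map_smul, smul_eq_mul, smul_eq_mul]
    ring
  set a := L (1, 0)
  set b := L (0, 1)
  rw [charFunDual_map, charFunDual_map, rowLaw, charFunDual_prod, charFunDual_prod,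
    charFunDual_stdGaussian_of_apply (a := a • x + b • y),
    charFunDual_gaussianReal_of_apply (c := a + b),
    charFunDual_gaussianReal_of_apply (c := τ * (a + b * cos θ)),
    charFunDual_gaussianReal_of_apply (c := τ * (b * sin θ)),
    ← Complex.exp_add, ← Complex.exp_add]
  · congr 1
    have hxx : (inner ℝ x x : ℝ) = 1 := by rw [real_inner_self_eq_norm_sq, hx]; norm_num
    have hyy : (inner ℝ y y : ℝ) = 1 := by rw [real_inner_self_eq_norm_sq, hy]; norm_num
    have hnorm : ‖a • x + b • y‖ ^ 2 = a ^ 2 + 2 * a * b * inner ℝ x y + b ^ 2 := by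
      rw [← real_inner_self_eq_norm_sq, inner_add_left, inner_add_right, inner_add_right]
      simp only [real_inner_smul_left, real_inner_smul_right, hxx, hyy, real_inner_comm x y]
      ring
    have hv : (((σ ^ 2).toNNReal : ℝ≥0) : ℝ) = σ ^ 2 := Real.coe_toNNReal _ (sq_nonneg σ)
    -- Equality of the two covariance forms: both have variances 1 + σ² and covariance ⟨x,y⟩ + σ²,
    -- the latter being `hθ`.
    have hkey : ‖a • x + b • y‖ ^ 2 + (((σ ^ 2).toNNReal : ℝ≥0) : ℝ) * (a + b) ^ 2
        = ((1 : ℝ≥0) : ℝ) * (τ * (a + b * cos θ)) ^ 2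
          + ((1 : ℝ≥0) : ℝ) * (τ * (b * sin θ)) ^ 2 := by
      rw [hnorm, hv, NNReal.coe_one, one_mul, one_mul, mul_pow, mul_pow, hτ2, mul_pow, sin_sq]
      linear_combination (-2 * a * b) * hθ
    rw [← add_div, ← add_div, ← neg_add, ← neg_add, ← Complex.ofReal_add, ← Complex.ofReal_add,
      hkey]
  all_goals
    intro t
    simp only [ContinuousLinearMap.comp_apply, ContinuousLinearMap.inl_apply,
      ContinuousLinearMap.inr_apply]
    rw [hL]
    simp [hT, hR, inner_add_left, real_inner_smul_left]
    try ring

/-- The common factor √(1 + σ²) does not affect signs, so the event becomes the planar wedge of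
angle θ. Cauchy–Schwarz keeps the argument of arccos in [-1, 1]. -/
lemma rowLaw_wedge {x y : E} (hx : ‖x‖ = 1) (hy : ‖y‖ = 1) (σ : ℝ) :
    (rowLaw E σ).real {p | 0 < inner ℝ x p.1 + p.2 ∧ inner ℝ y p.1 + p.2 ≤ 0}
      = arccos ((inner ℝ x y + σ ^ 2) / (1 + σ ^ 2)) / (2 * π) := by
  have hpos : 0 < 1 + σ ^ 2 := by positivity
  have hxy := abs_le.1 (abs_real_inner_le_norm x y)
  rw [hx, hy, mul_one] at hxy
  set θ := arccos ((inner ℝ x y + σ ^ 2) / (1 + σ ^ 2)) with hθ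
  have hcos : (1 + σ ^ 2) * cos θ = inner ℝ x y + σ ^ 2 := by
    rw [hθ, cos_arccos, mul_div_cancel₀ _ hpos.ne']
    · rw [le_div_iff₀ hpos]; nlinarith [sq_nonneg σ]
    · rw [div_le_iff₀ hpos]; linarith
  have hS : MeasurableSet {q : ℝ × ℝ | 0 < q.1 ∧ q.2 ≤ 0} :=
    (measurableSet_lt measurable_const measurable_fst).inter
      (measurableSet_le measurable_snd measurable_const)
  have h := congrArg (fun μ : Measure (ℝ × ℝ) => μ.real {q | 0 < q.1 ∧ q.2 ≤ 0})
    (map_rowLaw_eq hx hy σ hcos)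
  rw [map_measureReal_apply (by fun_prop) hS, map_measureReal_apply (by fun_prop) hS] at h
  have hτ : 0 < √(1 + σ ^ 2) := sqrt_pos.2 hpos
  rw [← gaussian_prod_wedge (arccos_nonneg _) (arccos_le_pi _), ← hθ]
  simp only [Set.preimage_ofPred_eq, mul_pos_iff_of_pos_left hτ, mul_nonpos_iff_right_of_pos hτ] at h
  exact h

end Bivariate

/-! ### Distance between the mean Hamming distance and the geodesic distance. -/

section Bias

open Real Set
open scoped symmDiff

variable {n : ℕ}

/-- The expected proportion of sign disagreements. -/
lemma rowLaw_symmDiff_halfSpace {x y : EuclideanSpace ℝ (Fin n)} (hx : ‖x‖ = 1) (hy : ‖y‖ = 1)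
    (σ : ℝ) :
    (rowLaw (EuclideanSpace ℝ (Fin n)) σ).real (halfSpace x 0 ∆ halfSpace y 0)
      = 1 / π * arccos ((inner ℝ x y + σ ^ 2) / (1 + σ ^ 2)) := by
  have h1 : ∀ u v : EuclideanSpace ℝ (Fin n), halfSpace u 0 \ halfSpace v 0
      = {p | 0 < inner ℝ u p.1 + p.2 ∧ inner ℝ v p.1 + p.2 ≤ 0} := by
    intro u v
    ext p
    simp [halfSpace]
  have h2 : ∀ u v : EuclideanSpace ℝ (Fin n), MeasurableSet (halfSpace u 0 \ halfSpace v 0) :=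
    fun u v => (measurableSet_halfSpace u 0).diff (measurableSet_halfSpace v 0)
  rw [Set.symmDiff_def, measureReal_union (disjoint_sdiff_sdiff) (h2 y x), h1, h1,
    rowLaw_wedge hx hy, rowLaw_wedge hy hx, real_inner_comm]
  field_simp
  ring

/-- The sign of the derivative reduces to 1 - t² ≤ (1 + v)² - (t + v)², whose two sides differ by
2v(1 - t). -/
lemma antitoneOn_arccos_sub {v : ℝ} (hv : 0 ≤ v) :
    AntitoneOn (fun t => arccos t - arccos ((t + v) / (1 + v))) (Icc (-1) 1) := by
  have hv1 : 0 < 1 + v := by linarith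
  refine antitoneOn_of_hasDerivWithinAt_nonpos (f' := fun t => -(1 / √(1 - t ^ 2))
    - -(1 / √(1 - ((t + v) / (1 + v)) ^ 2)) * (1 / (1 + v)))
    (convex_Icc _ _) ?_ ?_ ?_
  · exact (continuous_arccos.sub (continuous_arccos.comp (by fun_prop))).continuousOn
  · intro t ht
    rw [interior_Icc] at ht
    have hw1 : (t + v) / (1 + v) < 1 := by rw [div_lt_one hv1]; linarith [ht.2]
    have hw2 : -1 < (t + v) / (1 + v) := by rw [lt_div_iff₀ hv1]; linarith [ht.1]
    have h1 := hasDerivAt_arccos ht.1.ne' ht.2.ne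
    have h2 := (hasDerivAt_arccos hw2.ne' hw1.ne).comp t
      (((hasDerivAt_id t).add_const v).div_const (1 + v))
    exact (h1.sub h2).hasDerivWithinAt
  · intro t ht
    rw [interior_Icc] at ht
    have h1 : 0 < 1 - t ^ 2 := by nlinarith [ht.1, ht.2]
    have h2 : √(1 - t ^ 2) ≤ (1 + v) * √(1 - ((t + v) / (1 + v)) ^ 2) := by
      have h3 : (1 + v) * √(1 - ((t + v) / (1 + v)) ^ 2)
          = √((1 + v) ^ 2 * (1 - ((t + v) / (1 + v)) ^ 2)) := by
        rw [sqrt_mul (sq_nonneg _), sqrt_sq hv1.le]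
      rw [h3]
      refine sqrt_le_sqrt ?_
      have h4 : (1 + v) ^ 2 * (1 - ((t + v) / (1 + v)) ^ 2) = (1 + v) ^ 2 - (t + v) ^ 2 := by
        field_simp
      rw [h4]
      nlinarith [ht.1, ht.2]
    have h5 := one_div_le_one_div_of_le (sqrt_pos.2 h1) h2
    have h6 : 1 / ((1 + v) * √(1 - ((t + v) / (1 + v)) ^ 2))
        = 1 / √(1 - ((t + v) / (1 + v)) ^ 2) * (1 / (1 + v)) := by
      rw [one_div_mul_one_div, mul_comm]
    linarith

/-- Noise increases the correlation, so the bias has a fixed sign, and by monotonicity it is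
extremal at t = -1, where arccos t = π. -/
lemma abs_bias_le {t : ℝ} (h1 : -1 ≤ t) (h2 : t ≤ 1) (σ : ℝ) :
    |1 / π * arccos ((t + σ ^ 2) / (1 + σ ^ 2)) - 1 / π * arccos t|
      ≤ 1 - 1 / π * arccos ((σ ^ 2 - 1) / (σ ^ 2 + 1)) := by
  have hv : 0 ≤ σ ^ 2 := sq_nonneg σ
  have hv1 : 0 < 1 + σ ^ 2 := by positivity
  have hmono := antitoneOn_arccos_sub hv ⟨le_rfl, by norm_num⟩ ⟨h1, h2⟩ h1
  simp only [arccos_neg_one] at hmono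
  rw [show (-1 + σ ^ 2) / (1 + σ ^ 2) = (σ ^ 2 - 1) / (σ ^ 2 + 1) by ring_nf] at hmono
  have hle : arccos ((t + σ ^ 2) / (1 + σ ^ 2)) ≤ arccos t := by
    refine antitone_arccos ?_
    rw [le_div_iff₀ hv1]
    nlinarith
  have hpi : 0 < 1 / π := by positivity
  rw [← mul_sub, abs_mul, abs_of_pos hpi, abs_sub_comm, abs_of_nonneg (by linarith)]
  have h3 : (1 : ℝ) = 1 / π * π := by field_simp
  calc 1 / π * (arccos t - arccos ((t + σ ^ 2) / (1 + σ ^ 2)))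
      ≤ 1 / π * (π - arccos ((σ ^ 2 - 1) / (σ ^ 2 + 1))) := by gcongr
    _ = _ := by rw [mul_sub, ← h3]

end Bias

/-! ### From the Gaussian model to i.i.d. noisy rows, and the numerical constants. -/

section Model

open scoped symmDiff NNReal Matrix

variable {n m : ℕ}

/-- The characteristic function factorizes over coordinates; this needs no density, so σ = 0 is
covered. -/
lemma map_multivariateGaussian_smul_one (σ : ℝ) :
    (multivariateGaussian 0 (σ ^ 2 • (1 : Matrix (Fin m) (Fin m) ℝ))).map
        (fun x : EuclideanSpace ℝ (Fin m) => x.ofLp)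
      = Measure.pi fun _ => gaussianReal 0 (σ ^ 2).toNNReal := by
  set ν := multivariateGaussian 0 (σ ^ 2 • (1 : Matrix (Fin m) (Fin m) ℝ)) with hν
  have hm : Measurable fun x : EuclideanSpace ℝ (Fin m) => x.ofLp := by fun_prop
  have : IsProbabilityMeasure (ν.map fun x : EuclideanSpace ℝ (Fin m) => x.ofLp) :=
    Measure.isProbabilityMeasure_map hm.aemeasurable
  refine charFun_eq_pi_iff.1 fun t => ?_
  have hid : (WithLp.toLp 2 : (Fin m → ℝ) → EuclideanSpace ℝ (Fin m)) ∘
      (fun x : EuclideanSpace ℝ (Fin m) => x.ofLp) = id := by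
    funext x; simp
  rw [Measure.map_map (by fun_prop) hm, hid, Measure.map_id, hν,
    charFun_multivariateGaussian (Matrix.PosSemidef.one.smul (sq_nonneg σ))]
  simp only [charFun_gaussianReal]
  rw [← Complex.exp_sum]
  congr 1
  have hv : (((σ ^ 2).toNNReal : ℝ≥0) : ℝ) = σ ^ 2 := Real.coe_toNNReal _ (sq_nonneg σ)
  have hq : t.ofLp ⬝ᵥ (σ ^ 2 • (1 : Matrix (Fin m) (Fin m) ℝ)).mulVec t.ofLp
      = ∑ k, σ ^ 2 * t.ofLp k ^ 2 := by
    rw [Matrix.smul_mulVec, Matrix.one_mulVec]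
    exact Finset.sum_congr rfl fun k _ => by rw [Pi.smul_apply, smul_eq_mul]; ring
  rw [hq]
  simp only [hv, inner_zero_right, Complex.ofReal_zero, zero_mul, mul_zero, zero_sub,
    Finset.sum_neg_distrib, ← Finset.sum_div]
  push_cast
  rfl

/-- The rows of the matrix, each paired with its noise. -/
def noisyRows {Ω : Type*} (A : Ω → Matrix (Fin m) (Fin n) ℝ) (η : Ω → EuclideanSpace ℝ (Fin m))
    (ω : Ω) (k : Fin m) : EuclideanSpace ℝ (Fin n) × ℝ :=
  (rowVec (A ω) k, η ω k)

variable {Ω : Type*} [MeasurableSpace Ω] {P : Measure Ω} [IsProbabilityMeasure P]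
  {A : Ω → Matrix (Fin m) (Fin n) ℝ} {η : Ω → EuclideanSpace ℝ (Fin m)} {σ : ℝ}

omit [IsProbabilityMeasure P] in
lemma IsGaussianModel.aemeasurable_noisyRows (h : IsGaussianModel P A η σ) :
    AEMeasurable (noisyRows A η) P := by
  refine aemeasurable_pi_lambda _ fun k => ((h.row_law k).aemeasurable).prodMk ?_
  exact (show Measurable fun x : EuclideanSpace ℝ (Fin m) => x k by fun_prop).comp_aemeasurable
    h.noise_law.aemeasurable

/-- The noisy rows are independent and identically distributed. -/
lemma IsGaussianModel.map_noisyRows (h : IsGaussianModel P A η σ) :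
    P.map (noisyRows A η) = Measure.pi fun _ => rowLaw (EuclideanSpace ℝ (Fin n)) σ := by
  have hrowsm : AEMeasurable (fun ω (k : Fin m) => rowVec (A ω) k) P :=
    aemeasurable_pi_lambda _ fun k => (h.row_law k).aemeasurable
  have hηm := h.noise_law.aemeasurable
  have hrows : P.map (fun ω (k : Fin m) => rowVec (A ω) k)
      = Measure.pi fun _ => stdGaussian (EuclideanSpace ℝ (Fin n)) := by
    rw [(iIndepFun_iff_map_fun_eq_pi_map fun k => (h.row_law k).aemeasurable).1 h.row_indep]
    simp only [fun k => (h.row_law k).map_eq]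
  have hjoint := h.indep.map_prod_eq_prod_map_map hrowsm hηm
  rw [hrows, h.noise_law.map_eq] at hjoint
  have hofLp : Measurable fun x : EuclideanSpace ℝ (Fin m) => x.ofLp := by fun_prop
  set e := MeasurableEquiv.arrowProdEquivProdArrow (EuclideanSpace ℝ (Fin n)) ℝ (Fin m)
  have hcomp : noisyRows A η = e.symm ∘ Prod.map id (fun x : EuclideanSpace ℝ (Fin m) => x.ofLp) ∘
      fun ω => (fun (k : Fin m) => rowVec (A ω) k, η ω) := rfl
  rw [hcomp, ← Function.comp_assoc, ← AEMeasurable.map_map_of_aemeasurable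
    (e.symm.measurable.comp (measurable_id.prodMap hofLp)).aemeasurable (hrowsm.prodMk hηm),
    hjoint, ← Measure.map_map e.symm.measurable (measurable_id.prodMap hofLp),
    ← Measure.map_prod_map _ _ measurable_id hofLp, Measure.map_id,
    map_multivariateGaussian_smul_one]
  exact ((measurePreserving_arrowProdEquivProdArrow (EuclideanSpace ℝ (Fin n)) ℝ (Fin m)
    (fun _ => stdGaussian (EuclideanSpace ℝ (Fin n)))
    fun _ => gaussianReal 0 (σ ^ 2).toNNReal).symm e).map_eq

lemma sgn_ne_sgn_iff {a b : ℝ} : sgn a ≠ sgn b ↔ ¬ (0 < a ↔ 0 < b) := by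
  unfold sgn
  by_cases ha : 0 < a <;> by_cases hb : 0 < b <;> simp [ha, hb]

/-- The Hamming distance counts the noisy rows in the disagreement region. -/
lemma hammingMetric_noisySignMap (A : Matrix (Fin m) (Fin n) ℝ) (η : EuclideanSpace ℝ (Fin m))
    (x y : EuclideanSpace ℝ (Fin n)) :
    hammingMetric (noisySignMap A η x) (noisySignMap A η y)
      = (trace (halfSpace x 0 ∆ halfSpace y 0) fun k => (rowVec A k, η k)).card / m := by
  have hinner : ∀ (z : EuclideanSpace ℝ (Fin n)) (k : Fin m),
      A.mulVec z.ofLp k = inner ℝ z (rowVec A k) := by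
    intro z k
    rw [real_inner_eq_sum]
    change ∑ j, A k j * z j = ∑ j, z j * A k j
    exact Finset.sum_congr rfl fun j _ => mul_comm _ _
  unfold hammingMetric hammingDist
  congr 3
  ext k
  simp only [Finset.mem_filter, Finset.mem_univ, true_and, mem_trace, noisySignMap, sgn_ne_sgn_iff,
    Set.mem_symmDiff, halfSpace, Set.mem_ofPred_eq, hinner]
  tauto

/-- A small uniform deviation of the empirical counts gives the restricted isometry property. -/
lemma hasRIP_of_deviation_le (hm : 0 < m) {s : ℕ} {δ : ℝ} {A : Matrix (Fin m) (Fin n) ℝ}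
    {η : EuclideanSpace ℝ (Fin m)}
    (h : ∀ x ∈ sparseSphere n s, ∀ y ∈ sparseSphere n s,
      |((trace (halfSpace x 0 ∆ halfSpace y 0) fun k => (rowVec A k, η k)).card : ℝ)
        - m * (rowLaw (EuclideanSpace ℝ (Fin n)) σ).real (halfSpace x 0 ∆ halfSpace y 0)|
      ≤ gap δ σ * m) :
    HasRIP s δ (noisySignMap A η) := by
  intro x hx y hy
  have hm0 : (0 : ℝ) < m := by exact_mod_cast hm
  have hxy := h x hx y hy
  rw [hammingMetric_noisySignMap]
  set N : ℝ := ((trace (halfSpace x 0 ∆ halfSpace y 0) fun k => (rowVec A k, η k)).card : ℝ)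
  set p := (rowLaw (EuclideanSpace ℝ (Fin n)) σ).real (halfSpace x 0 ∆ halfSpace y 0) with hp
  have h1 : |N / m - p| ≤ gap δ σ := by
    rw [show N / m - p = (N - m * p) / m by field_simp, abs_div, abs_of_pos hm0,
      div_le_iff₀ hm0]
    exact hxy
  have hin := abs_le.1 (abs_real_inner_le_norm x y)
  rw [hx.1, hy.1, mul_one] at hin
  have h2 := abs_bias_le hin.1 hin.2 σ
  rw [← rowLaw_symmDiff_halfSpace hx.1 hy.1, ← hp] at h2
  -- `gap δ σ` plus the bias bound is exactly δ.
  have h3 := abs_sub_le (N / m) p (geodesicDist x y)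
  unfold geodesicDist at h3 ⊢
  unfold gap at h1
  linarith

/-- The restricted isometry property holds with the probability given by uniform deviation. -/
lemma IsGaussianModel.holdsWithProb_hasRIP (h : IsGaussianModel P A η σ) (hm : 0 < m) {s : ℕ}
    (hs : 1 ≤ s) (hsn : s ≤ n) {δ ε : ℝ} (hε : 0 < ε) (hg : 0 ≤ gap δ σ)
    (hbound : 3 * Real.exp (320 * sparseEntropy n s - gap δ σ ^ 2 * m / 40) ≤ ε) :
    HoldsWithProb P (1 - ε) fun ω => HasRIP s δ (noisySignMap (A ω) (η ω)) := by
  set B : Set (Fin m → EuclideanSpace ℝ (Fin n) × ℝ) :=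
    {z | ∃ x ∈ sparseSphere n s, ∃ y ∈ sparseSphere n s,
      gap δ σ * m < |((trace (halfSpace x 0 ∆ halfSpace y 0) z).card : ℝ)
        - m * (rowLaw (EuclideanSpace ℝ (Fin n)) σ).real (halfSpace x 0 ∆ halfSpace y 0)|} with hB
  have hPB : P (noisyRows A η ⁻¹' B) ≤ ENNReal.ofReal ε := by
    refine (Measure.le_map_apply h.aemeasurable_noisyRows B).trans ?_
    rw [h.map_noisyRows]
    exact (measure_exists_sparse_deviation_le _ m hs hsn hg).trans (ENNReal.ofReal_le_ofReal hbound)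
  -- The failure event is an uncountable union, controlled only in outer measure; the complement of
  -- its measurable hull serves as the good event.
  refine ⟨(toMeasurable P (noisyRows A η ⁻¹' B))ᶜ, (measurableSet_toMeasurable _ _).compl, ?_,
    fun ω hω => ?_⟩
  · rw [prob_compl_eq_one_sub (measurableSet_toMeasurable _ _), measure_toMeasurable,
      ENNReal.ofReal_sub _ hε.le, ENNReal.ofReal_one]
    exact tsub_le_tsub_left hPB 1
  · have hω' : noisyRows A η ω ∉ B := fun hmem => hω (subset_toMeasurable P _ hmem)
    refine hasRIP_of_deviation_le (σ := σ) hm fun x hx y hy => ?_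
    by_contra! hcon
    exact hω' ⟨x, hx, y, hy, hcon⟩

/-- Here 12800 = 40 · 320: the entropy terms cancel and the rest is more than enough for exp(-2
log(2/ε)) = ε²/4, with 3ε²/4 ≤ ε. -/
lemma failure_bound_le {g L ε M : ℝ} (hg : 0 < g) (hε : 0 < ε) (hε1 : ε < 1)
    (hM : 12800 * (g ^ 2)⁻¹ * (Real.log (2 / ε) + L) ≤ M) :
    3 * Real.exp (320 * L - g ^ 2 * M / 40) ≤ ε := by
  have h1 : 320 * (Real.log (2 / ε) + L) ≤ g ^ 2 * M / 40 := by
    have h2 := mul_le_mul_of_nonneg_left hM (sq_nonneg g)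
    have h3 : g ^ 2 * (12800 * (g ^ 2)⁻¹ * (Real.log (2 / ε) + L))
        = 12800 * (Real.log (2 / ε) + L) := by field_simp
    linarith
  have h2 : 0 ≤ Real.log (2 / ε) := Real.log_nonneg (by rw [le_div_iff₀ hε]; linarith)
  have h3 : Real.exp (320 * L - g ^ 2 * M / 40) ≤ Real.exp (-(2 * Real.log (2 / ε))) :=
    Real.exp_le_exp.2 (by linarith)
  have h4 : Real.exp (-(2 * Real.log (2 / ε))) = ε ^ 2 / 4 := by
    rw [Real.exp_neg, two_mul, Real.exp_add, Real.exp_log (by positivity)]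
    field_simp
    norm_num
  rw [h4] at h3
  nlinarith

/-- For n ≥ 2s the extra 1 = log e is at most (3/2) log 2 ≤ (3/2) log(n/s). -/
lemma sparseEntropy_le {s : ℕ} (hs : 1 ≤ s) (h2s : 2 * s ≤ n) :
    sparseEntropy n s ≤ 5 / 2 * (s * Real.log (n / s)) := by
  have hs0 : (0 : ℝ) < s := by exact_mod_cast hs
  have h2s' : (2 : ℝ) * s ≤ n := by exact_mod_cast h2s
  have hn0 : (0 : ℝ) < n := by linarith
  have hlog : Real.log 2 ≤ Real.log (n / s) :=
    Real.log_le_log (by norm_num) (by rwa [le_div_iff₀ hs0])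
  have h2 := Real.log_two_gt_d9
  have h3 : Real.log (Real.exp 1 * n / s) = 1 + Real.log (n / s) := by
    rw [mul_div_assoc, Real.log_mul (Real.exp_pos 1).ne' (by positivity), Real.log_exp]
  unfold sparseEntropy
  rw [h3, mul_left_comm]
  exact mul_le_mul_of_nonneg_left (by linarith) hs0.le

end Model

end OneBit

theorem corollary2p6 :
    ∃ C : ℝ, 0 < C ∧
      ∀ (n m s : ℕ) (σ ε δ : ℝ), 1 ≤ s → s ≤ n → 0 ≤ σ → 0 < ε → ε < 1 →
        1 - 1 / Real.pi * Real.arccos ((σ ^ 2 - 1) / (σ ^ 2 + 1)) < δ →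
        ∀ {Ω : Type*} [MeasurableSpace Ω] (P : Measure Ω) [IsProbabilityMeasure P]
          (A : Ω → Matrix (Fin m) (Fin n) ℝ) (η : Ω → EuclideanSpace ℝ (Fin m)),
          OneBit.IsGaussianModel P A η σ →
          -- the form with `log (e n / s)`, for every sparsity level
          (C * (OneBit.gap δ σ ^ 2)⁻¹ *
              (Real.log (2 / ε) + (s : ℝ) * Real.log (Real.exp 1 * (n : ℝ) / (s : ℝ))) ≤ (m : ℝ) →
            OneBit.HoldsWithProb P (1 - ε)
              (fun ω => OneBit.HasRIP s δ (OneBit.noisySignMap (A ω) (η ω)))) ∧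
          -- the form with `log (n / s)`, for sparsity levels at most `n / 2`
          (2 * s ≤ n →
            C * (OneBit.gap δ σ ^ 2)⁻¹ *
              (Real.log (2 / ε) + (s : ℝ) * Real.log ((n : ℝ) / (s : ℝ))) ≤ (m : ℝ) →
            OneBit.HoldsWithProb P (1 - ε)
              (fun ω => OneBit.HasRIP s δ (OneBit.noisySignMap (A ω) (η ω)))) := by
  -- 32000 = (5/2) · 12800: the factor 5/2 pays for replacing log(en/s) by log(n/s).
  refine ⟨32000, by norm_num, fun n m s σ ε δ hs hsn hσ hε hε1 hδ Ω _ P _ A η hmodel => ?_⟩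
  have hg : 0 < OneBit.gap δ σ := by unfold OneBit.gap; linarith
  have hs0 : (0 : ℝ) < s := by exact_mod_cast hs
  have hlogε : 0 < Real.log (2 / ε) := Real.log_pos (by rw [lt_div_iff₀ hε]; linarith)
  have hL0 : 0 ≤ OneBit.sparseEntropy n s := hs0.le.trans (OneBit.le_sparseEntropy hs hsn)
  have hginv : 0 < (OneBit.gap δ σ ^ 2)⁻¹ := by positivity
  have key : 12800 * (OneBit.gap δ σ ^ 2)⁻¹ *
      (Real.log (2 / ε) + OneBit.sparseEntropy n s) ≤ (m : ℝ) →
      OneBit.HoldsWithProb P (1 - ε)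
        (fun ω => OneBit.HasRIP s δ (OneBit.noisySignMap (A ω) (η ω))) := by
    intro hm
    -- The lower bound on m is strictly positive, which excludes m = 0, where the Hamming metric
    -- would be the default 0 / 0 = 0.
    have hm0 : (0 : ℝ) < m := lt_of_lt_of_le (by positivity) hm
    exact hmodel.holdsWithProb_hasRIP (by exact_mod_cast hm0) hs hsn hε hg.le
      (OneBit.failure_bound_le hg hε hε1 hm)
  refine ⟨fun hm => key (le_trans ?_ hm), fun h2s hm => key (le_trans ?_ hm)⟩
  · change _ ≤ 32000 * (OneBit.gap δ σ ^ 2)⁻¹ * (Real.log (2 / ε) + OneBit.sparseEntropy n s)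
    gcongr
    norm_num
  · have h := OneBit.sparseEntropy_le hs h2s
    rw [mul_right_comm, mul_right_comm 32000]
    refine mul_le_mul_of_nonneg_right ?_ hginv.le
    linarith
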